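/- In the bidirectional scheduling problem we are given $m$ segments $1,\dots,m$, ordered from left to right, with transit times $\tau_i\in\mathbb{N}$, and a set $J$ of $n$ jobs, each of which is either rightbound or leftbound and has a release date $r_j\in\mathbb{N}$, a processing time $p_j\in\mathbb{N}$, a start segment $s_j$ and a target segment $t_j$ ($s_j\le t_j$ if $j$ is rightbound, $s_j\ge t_j$ if $j$ is leftbound; here $0\in\mathbb{N}$); job $j$ has to cross all segments from $s_j$ to $t_j$, in this order. For each segment $i$ we are also given a bipartite compatibility graph $G_i$ whose edges join rightbound to leftbound jobs; two jobs are compatible on $i$ if they are joined by an edge of $G_i$. A schedule fixes a start time $S_{ij}$ for each job $j$ on each segment $i$ that it crosses; $C_{ij}=S_{ij}+p_j+\tau_i$ is the completion time of $j$ on $i$, and $C_j=C_{t_jj}$. The schedule is feasible if (1) $r_j\le S_{s_jj}$ for every job $j$; (2) $C_{ij}\le S_{i'j}$ whenever $j$ crosses $i'$ directly after $i$; (3) $[S_{ij},S_{ij}+p_j)\cap[S_{ij'},S_{ij'}+p_{j'})=\emptyset$ for any two distinct jobs $j,j'$ of the same direction that both cross $i$; and (4) $[S_{ij},C_{ij})\cap[S_{ij'},C_{ij'})=\emptyset$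 for any two jobs $j,j'$ of different directions that both cross $i$ and are not compatible on $i$. The task is to find a feasible schedule that minimizes the total completion time $\sum_{j\in J}C_j$. Two jobs of the same direction have the same compatibility type if, on each segment, they are compatible with exactly the same jobs. **Theorem.** For every constant $\kappa$, the bidirectional scheduling problem, restricted to instances with a single segment ($m=1$), with identical processing times ($p_j=p$ for all $j\in J$) and with at most $\kappa$ compatibility types, can be solved in polynomial time; that is, there is an algorithm that, on each such instance, outputs an optimal schedule in time polynomial in the length of the input (with all numbers written in binary). -/

import Mathlib

namespace BidirScheduling

/-! ### The bidirectional scheduling problem -/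

/-- An instance of bidirectional scheduling with `m` segments, ordered from left to right, and `n`
jobs. All numbers are natural numbers, and `0` is allowed. -/
structure Inst where
  /-- number of segments -/
  m : ℕ
  /-- number of jobs -/
  n : ℕ
  /-- transit time of each segment -/
  transit : Fin m → ℕ
  /-- `true` for rightbound jobs, `false` for leftbound jobs -/
  right : Fin n → Bool
  /-- release dates -/
  release : Fin n → ℕ
  /-- processing times -/
  proc : Fin n → ℕ
  /-- start segments -/
  source : Fin n → Fin m
  /-- target segments -/
  target : Fin n → Fin m
  /-- rightbound jobs travel from left to right -/
  source_le_target : ∀ j, right j = true → source j ≤ target j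
  /-- leftbound jobs travel from right to left -/
  target_le_source : ∀ j, right j = false → target j ≤ source j
  /-- the edge set of the bipartite compatibility graph of each segment, as a set of pairs
  (rightbound job, leftbound job) -/
  edge : Fin m → Fin n → Fin n → Bool
  /-- edges go from rightbound to leftbound jobs -/
  edge_dir : ∀ i j j', edge i j j' = true → right j = true ∧ right j' = false

namespace Inst

variable (I : Inst)

/-- The segments that job `j` has to cross. -/
def segments (j : Fin I.n) : Set (Fin I.m) := Set.uIcc (I.source j) (I.target j)

/-- `j` and `j'` are joined by an (undirected) edge of the compatibility graph of segment `i`. -/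
def Compatible (i : Fin I.m) (j j' : Fin I.n) : Prop :=
  I.edge i j j' = true ∨ I.edge i j' j = true

/-- A schedule fixes the start time `S i j` of job `j` on every segment `i` that `j` crosses
(the values `S i j` for other segments play no role). -/
abbrev Schedule := Fin I.m → Fin I.n → ℝ

/-- Completion time of job `j` on segment `i`. -/
def segCompletion (S : I.Schedule) (i : Fin I.m) (j : Fin I.n) : ℝ :=
  S i j + I.proc j + I.transit i

/-- Overall completion time of job `j`. -/
def completion (S : I.Schedule) (j : Fin I.n) : ℝ := I.segCompletion S (I.target j) j

/-- The time during which job `j` is processed on segment `i`. -/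
def processing (S : I.Schedule) (i : Fin I.m) (j : Fin I.n) : Set ℝ :=
  Set.Ico (S i j) (S i j + I.proc j)

/-- The time during which job `j` is processed or in transit on segment `i`. -/
def running (S : I.Schedule) (i : Fin I.m) (j : Fin I.n) : Set ℝ :=
  Set.Ico (S i j) (I.segCompletion S i j)

/-- Feasible schedules. -/
structure Feasible (S : I.Schedule) : Prop where
  release_le : ∀ j, (I.release j : ℝ) ≤ S (I.source j) j
  travel_right : ∀ j, I.right j = true → ∀ i ∈ I.segments j, ∀ i' ∈ I.segments j,
    i'.val = i.val + 1 → I.segCompletion S i j ≤ S i' j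
  travel_left : ∀ j, I.right j = false → ∀ i ∈ I.segments j, ∀ i' ∈ I.segments j,
    i.val = i'.val + 1 → I.segCompletion S i j ≤ S i' j
  same_direction : ∀ i j j', j ≠ j' → i ∈ I.segments j → i ∈ I.segments j' →
    I.right j = I.right j' → I.processing S i j ∩ I.processing S i j' = ∅
  opposite_direction : ∀ i j j', i ∈ I.segments j → i ∈ I.segments j' →
    I.right j ≠ I.right j' → ¬ I.Compatible i j j' → I.running S i j ∩ I.running S i j' = ∅

/-- The objective function. -/
def totalCompletion (S : I.Schedule) : ℝ := ∑ j, I.completion S j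

/-- Optimal schedules: feasible, and of minimum total completion time among all feasible ones. -/
def Optimal (S : I.Schedule) : Prop :=
  I.Feasible S ∧ ∀ S' : I.Schedule, I.Feasible S' → I.totalCompletion S ≤ I.totalCompletion S'

/-- Two jobs have the same compatibility type if they have the same direction and, on each segment,
the same set of compatible jobs. -/
def sameType : Setoid (Fin I.n) where
  r j₁ j₂ := I.right j₁ = I.right j₂ ∧
    ∀ i, {j | I.Compatible i j₁ j} = {j | I.Compatible i j₂ j}
  iseqv := ⟨fun _ => ⟨rfl, fun _ => rfl⟩, fun h => ⟨h.1.symm, fun i => (h.2 i).symm⟩,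
    fun h h' => ⟨h.1.trans h'.1, fun i => (h.2 i).trans (h'.2 i)⟩⟩

/-- The number of compatibility types that occur in the instance. -/
noncomputable def numTypes : ℕ := Nat.card (Quotient I.sameType)

/-- The input that describes the instance: `m`, `n`, the transit times, then the data of the jobs
one after the other, then the adjacency matrices of the compatibility graphs. -/
def encode : List ℕ :=
  [I.m, I.n] ++ List.ofFn I.transit ++
  (List.finRange I.n).flatMap (fun j =>
    [(I.right j).toNat, I.release j, I.proc j, (I.source j).val, (I.target j).val]) ++
  (List.finRange I.m).flatMap (fun i => (List.finRange I.n).flatMap (fun j =>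
    (List.finRange I.n).map (fun j' => (I.edge i j j').toNat)))

/-- A table of integral start times, segment by segment, as a list. -/
def encodeSchedule (T : Fin I.m → Fin I.n → ℕ) : List ℕ :=
  (List.finRange I.m).flatMap (fun i => (List.finRange I.n).map (T i))

end Inst

/-! ### Random access machines with logarithmic cost

The machine has a read-only input, a memory of cells indexed by `ℕ`, each holding a natural number,
indirect addressing, and a write-only output. Programs are given in structured form, and every
number that is read, computed, or used as an address is charged its length in binary. -/

/-- Binary length of a number, plus one for a separator. -/
def bitLength (k : ℕ) : ℕ := Nat.size k + 1

/-- The length of a list of numbers written in binary. -/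
def inputSize (x : List ℕ) : ℕ := (x.map bitLength).sum

/-- Expressions: constants, the `e`-th entry of the input, the content of memory cell number `e`,
sum, truncated difference, and product. -/
inductive Expr : Type
  | const (k : ℕ)
  | input (e : Expr)
  | mem (e : Expr)
  | add (e f : Expr)
  | sub (e f : Expr)
  | mul (e f : Expr)

namespace Expr

/-- Value of an expression, for input `x` and memory `M`. Input positions beyond the end of the
input read as `0`. -/
def eval (x : List ℕ) (M : ℕ → ℕ) : Expr → ℕ
  | const k => k
  | input e => x.getD (e.eval x M) 0
  | mem e => M (e.eval x M)
  | add e f => e.eval x M + f.eval x M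
  | sub e f => e.eval x M - f.eval x M
  | mul e f => e.eval x M * f.eval x M

/-- Cost of evaluating an expression: the total length of the values of its subexpressions. -/
def cost (x : List ℕ) (M : ℕ → ℕ) : Expr → ℕ
  | const k => bitLength k
  | input e => e.cost x M + bitLength ((input e).eval x M)
  | mem e => e.cost x M + bitLength ((mem e).eval x M)
  | add e f => e.cost x M + f.cost x M + bitLength ((add e f).eval x M)
  | sub e f => e.cost x M + f.cost x M + bitLength ((sub e f).eval x M)
  | mul e f => e.cost x M + f.cost x M + bitLength ((mul e f).eval x M)

end Expr

/-- Programs. `store a e` puts the value of `e` into memory cell number `a`, `write e` appends the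
value of `e` to the output, and tests succeed if the value is not zero. -/
inductive Prog : Type
  | skip
  | store (a e : Expr)
  | write (e : Expr)
  | seq (c d : Prog)
  | ite (e : Expr) (c d : Prog)
  | while (e : Expr) (c : Prog)

/-- Content of the memory and of the output. -/
structure State where
  mem : ℕ → ℕ
  out : List ℕ

/-- At the beginning all memory cells are zero and the output is empty. -/
def State.init : State := ⟨fun _ => 0, []⟩

/-- `Exec x c s t s'`: on input `x`, the program `c` started in state `s` halts in state `s'`, at
total cost `t`. -/
inductive Exec (x : List ℕ) : Prog → State → ℕ → State → Prop
  | skip (s : State) : Exec x Prog.skip s 1 s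
  | store (a e : Expr) (s : State) :
      Exec x (Prog.store a e) s (a.cost x s.mem + e.cost x s.mem + 1)
        ⟨Function.update s.mem (a.eval x s.mem) (e.eval x s.mem), s.out⟩
  | write (e : Expr) (s : State) :
      Exec x (Prog.write e) s (e.cost x s.mem + 1) ⟨s.mem, s.out ++ [e.eval x s.mem]⟩
  | seq {c d : Prog} {s s' s'' : State} {t t' : ℕ} :
      Exec x c s t s' → Exec x d s' t' s'' → Exec x (Prog.seq c d) s (t + t' + 1) s''
  | ite_true {e : Expr} {c d : Prog} {s s' : State} {t : ℕ} :
      e.eval x s.mem ≠ 0 → Exec x c s t s' →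
        Exec x (Prog.ite e c d) s (e.cost x s.mem + t + 1) s'
  | ite_false {e : Expr} {c d : Prog} {s s' : State} {t : ℕ} :
      e.eval x s.mem = 0 → Exec x d s t s' →
        Exec x (Prog.ite e c d) s (e.cost x s.mem + t + 1) s'
  | while_true {e : Expr} {c : Prog} {s s' s'' : State} {t t' : ℕ} :
      e.eval x s.mem ≠ 0 → Exec x c s t s' → Exec x (Prog.while e c) s' t' s'' →
        Exec x (Prog.while e c) s (e.cost x s.mem + t + t' + 1) s''
  | while_false {e : Expr} {c : Prog} {s : State} :
      e.eval x s.mem = 0 → Exec x (Prog.while e c) s (e.cost x s.mem + 1) s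

/-- The machine is deterministic: a program has at most one halting run on each input. -/
theorem Exec.deterministic {x : List ℕ} {c : Prog} {s s₁ s₂ : State} {t₁ t₂ : ℕ}
    (h₁ : Exec x c s t₁ s₁) (h₂ : Exec x c s t₂ s₂) : t₁ = t₂ ∧ s₁ = s₂ := by
  induction h₁ generalizing t₂ s₂ with
  | skip s => cases h₂; exact ⟨rfl, rfl⟩
  | store a e s => cases h₂; exact ⟨rfl, rfl⟩
  | write e s => cases h₂; exact ⟨rfl, rfl⟩
  | seq _ _ ih ih' =>
    cases h₂ with
    | seq g g' =>
      obtain ⟨rfl, rfl⟩ := ih g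
      obtain ⟨rfl, rfl⟩ := ih' g'
      exact ⟨rfl, rfl⟩
  | ite_true h _ ih =>
    cases h₂ with
    | ite_true _ g => obtain ⟨rfl, rfl⟩ := ih g; exact ⟨rfl, rfl⟩
    | ite_false h' _ => exact absurd h' h
  | ite_false h _ ih =>
    cases h₂ with
    | ite_true h' _ => exact absurd h h'
    | ite_false _ g => obtain ⟨rfl, rfl⟩ := ih g; exact ⟨rfl, rfl⟩
  | while_true h _ _ ih ih' =>
    cases h₂ with
    | while_true _ g g' =>
      obtain ⟨rfl, rfl⟩ := ih g
      obtain ⟨rfl, rfl⟩ := ih' g'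
      exact ⟨rfl, rfl⟩
    | while_false h' => exact absurd h' h
  | while_false h =>
    cases h₂ with
    | while_true h' _ _ => exact absurd h h'
    | while_false _ => exact ⟨rfl, rfl⟩

/-- The bidirectional scheduling problem, restricted to the instances with property `P`, can be
solved in polynomial time: there are one program and one polynomial such that, on each of these
instances, the program halts within time polynomial in the length of the input and outputs the
start times of an optimal schedule. -/
def SolvableInPolyTime (P : Inst → Prop) : Prop :=
  ∃ (c : Prog) (q : Polynomial ℕ), ∀ I : Inst, P I →
    ∃ (t : ℕ) (s : State) (T : Fin I.m → Fin I.n → ℕ),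
      Exec I.encode c State.init t s ∧
      t ≤ q.eval (inputSize I.encode) ∧
      s.out = I.encodeSchedule T ∧
      I.Optimal (fun i j => (T i j : ℝ))

end BidirScheduling

/-! With one segment and a common processing time `p`, a schedule is a vector of start times.
Feasibility means that no job starts before its release date and that the starts of two jobs `j`,
`k` differ by at least `d j k`: `0` for compatible jobs, `p` for jobs of the same direction, `q = p
+ τ` for incompatible jobs of opposite directions. The objective is the sum of the start times plus
a constant. Jobs of the same type have the same row of `d`, so `d` has at most `κ` distinct rows.

Fix the jobs in order of their starts. Swapping the start times of two jobs with equal rows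
preserves all distances, so jobs with the same row may be taken by release date, and the next job
may start as early as the fixed jobs allow (`exists_eligible_extend`). Hence, within each row class,
the fixed jobs are an initial segment of the priority order, and they impose one common lower bound
on the starts of the remaining jobs of the class. This bound is `0` or of the form `r j + a * p + b
* q` with `a, b ≤ n`. A threshold and a bound per row therefore determine everything that matters
for the future (`Valid.extend`), which leaves polynomially many states for constant `κ`
(`card_le_of_valid`). A dynamic program that keeps, after each number of fixed jobs, one cheapest
partial schedule per state is exact, even against real-valued schedules.

The remaining work is to run this on the machine. `Runs` is a program logic that counts steps and
keeps every stored number below `M`; all values of subexpressions are then at most a fixed power of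
`M`, so one step costs a constant times the length of `M`. `Runs.schedule` proves the program
correct, `completes_iff_feasible` translates between `d` and feasibility, and `setting_encode`
supplies an `M` of polynomial length. -/

namespace BidirScheduling

/-! ### Partial schedules

We are given release dates `r` and a symmetric matrix `d` of minimum distances between start times.
A partial schedule is built up by repeatedly fixing the start time of a job that is started last so
far. -/

/-- A partial schedule: which jobs are done (flag `1`), the start times of the jobs that are done,
the earliest possible start times of all other jobs, and the sum of the fixed start times. -/
@[ext] structure PartialSchedule (n : ℕ) where
  done : Fin n → ℕ
  start : Fin n → ℕ
  cost : ℕ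

/-- Jobs are compared by release date, ties being broken by index. -/
def priority {n : ℕ} (r : Fin n → ℕ) (k : Fin n) : ℕ := r k * n + k

/-- Indices are below `n`, so the release date is the leading part of the priority in base `n`. -/
theorem release_le_of_priority_le {n : ℕ} {r : Fin n → ℕ} {j k : Fin n}
    (h : priority r j ≤ priority r k) : r j ≤ r k := by
  by_contra! hlt
  have := Nat.mul_le_mul_right n (Nat.succ_le_of_lt hlt)
  have hk := k.isLt
  unfold priority at h
  rw [Nat.succ_mul] at this
  omega

theorem priority_injective {n : ℕ} (r : Fin n → ℕ) : Function.Injective (priority r) := by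
  intro j k h
  have h₁ := release_le_of_priority_le h.le
  have h₂ := release_le_of_priority_le h.ge
  unfold priority at h
  rw [le_antisymm h₁ h₂] at h
  exact Fin.ext (by omega)

/-- The times that can occur as start times after at most `l` steps. -/
def candidates {n : ℕ} (r : Fin n → ℕ) (p q l : ℕ) : Finset ℕ :=
  insert 0 ((Finset.univ ×ˢ Finset.range (l + 1) ×ˢ Finset.range (l + 1)).image
    fun t : Fin n × ℕ × ℕ => r t.1 + t.2.1 * p + t.2.2 * q)

/-- Thresholds for priorities. -/
def thresholds {n : ℕ} (r : Fin n → ℕ) : Finset ℕ :=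
  insert 0 (Finset.univ.image fun k => priority r k + 1)

theorem card_thresholds_le {n : ℕ} (r : Fin n → ℕ) : (thresholds r).card ≤ n + 1 := by
  refine (Finset.card_insert_le _ _).trans (Nat.succ_le_succ (Finset.card_image_le.trans ?_))
  simp

theorem card_candidates_le {n : ℕ} (r : Fin n → ℕ) (p q l : ℕ) :
    (candidates r p q l).card ≤ n * (l + 1) ^ 2 + 1 := by
  refine (Finset.card_insert_le _ _).trans (Nat.succ_le_succ (Finset.card_image_le.trans ?_))
  simp [Finset.card_product, sq]

theorem mem_candidates {n : ℕ} {r : Fin n → ℕ} {p q l v : ℕ} :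
    v ∈ candidates r p q l ↔
      v = 0 ∨ ∃ j, ∃ a ≤ l, ∃ b ≤ l, r j + a * p + b * q = v := by
  simp only [candidates, Finset.mem_insert, Finset.mem_image, Finset.mem_product, Finset.mem_univ,
    Finset.mem_range, true_and, Prod.exists, Nat.lt_succ_iff]
  constructor
  · rintro (h | ⟨j, a, b, ⟨ha, hb⟩, h⟩)
    exacts [.inl h, .inr ⟨j, a, ha, b, hb, h⟩]
  · rintro (h | ⟨j, a, ha, b, hb, h⟩)
    exacts [.inl h, .inr ⟨j, a, b, ⟨ha, hb⟩, h⟩]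

theorem candidates_mono {n : ℕ} {r : Fin n → ℕ} {p q l l' : ℕ} (h : l ≤ l') :
    candidates r p q l ⊆ candidates r p q l' := by
  intro v hv
  rw [mem_candidates] at hv ⊢
  obtain hv | ⟨j, a, ha, b, hb, hv⟩ := hv
  exacts [.inl hv, .inr ⟨j, a, ha.trans h, b, hb.trans h, hv⟩]

theorem release_mem_candidates {n : ℕ} (r : Fin n → ℕ) (p q l : ℕ) (k : Fin n) :
    r k ∈ candidates r p q l :=
  mem_candidates.2 (.inr ⟨k, 0, zero_le, 0, zero_le, by simp⟩)

/-- The maximum of two candidates is one of them, and adding a distance raises at most one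
coefficient by one. This is why `l + 1` steps need coefficients only up to `l + 1`. -/
theorem max_release_add_mem_candidates {n : ℕ} {r : Fin n → ℕ} {p q l w δ : ℕ} (k : Fin n)
    (hw : w ∈ candidates r p q l) (hδ : δ = 0 ∨ δ = p ∨ δ = q) :
    max (r k) w + δ ∈ candidates r p q (l + 1) := by
  have key : ∃ j, ∃ a ≤ l, ∃ b ≤ l, r j + a * p + b * q = max (r k) w := by
    rcases le_total (r k) w with h | h
    · obtain rfl | ⟨j, a, ha, b, hb, hv⟩ := mem_candidates.1 hw
      · exact ⟨k, 0, zero_le, 0, zero_le, by simp⟩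
      · exact ⟨j, a, ha, b, hb, by simp [hv, h]⟩
    · exact ⟨k, 0, zero_le, 0, zero_le, by simp [h]⟩
  obtain ⟨j, a, ha, b, hb, hv⟩ := key
  refine mem_candidates.2 (.inr ?_)
  rw [← hv]
  rcases hδ with rfl | rfl | rfl
  · exact ⟨j, a, by omega, b, by omega, by ring⟩
  · exact ⟨j, a + 1, by omega, b, by omega, by ring⟩
  · exact ⟨j, a, by omega, b + 1, by omega, by ring⟩

theorem le_of_mem_candidates {n : ℕ} {r : Fin n → ℕ} {p q l v X : ℕ}
    (hv : v ∈ candidates r p q l) (hr : ∀ k, r k ≤ X) : v ≤ X + l * p + l * q := by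
  obtain rfl | ⟨j, a, ha, b, hb, rfl⟩ := mem_candidates.1 hv
  · exact zero_le
  · exact Nat.add_le_add (Nat.add_le_add (hr j) (Nat.mul_le_mul_right _ ha))
      (Nat.mul_le_mul_right _ hb)

namespace PartialSchedule

variable {n : ℕ}

/-- The empty schedule. -/
def empty (r : Fin n → ℕ) : PartialSchedule n := ⟨fun _ => 0, r, 0⟩

/-- Fix the start time of job `j`. -/
def extend (d : Fin n → Fin n → ℕ) (c : PartialSchedule n) (j : Fin n) : PartialSchedule n where
  done k := c.done k + if k = j then 1 else 0
  start k := if c.done k = 0 ∧ k ≠ j then max (c.start k) (c.start j + d j k) else c.start k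
  cost := c.cost + c.start j

/-- A job may be started next if it has the least priority value among the remaining jobs with the
same row of distances. -/
def Eligible (r : Fin n → ℕ) (d : Fin n → Fin n → ℕ) (c : PartialSchedule n) (j : Fin n) : Prop :=
  c.done j = 0 ∧ ∀ k, c.done k = 0 → d j = d k → priority r j ≤ priority r k

/-- The two partial schedules have the same completions. -/
def SameKey (c c' : PartialSchedule n) : Prop :=
  ∀ k, c.done k = c'.done k ∧ (c.done k = 0 → c.start k = c'.start k)

theorem SameKey.refl (c : PartialSchedule n) : SameKey c c := fun _ => ⟨rfl, fun _ => rfl⟩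

theorem SameKey.symm {c c' : PartialSchedule n} (h : SameKey c c') : SameKey c' c :=
  fun k => ⟨(h k).1.symm, fun h' => ((h k).2 ((h k).1.trans h')).symm⟩

theorem SameKey.trans {c c' c'' : PartialSchedule n} (h : SameKey c c') (h' : SameKey c' c'') :
    SameKey c c'' :=
  fun k => ⟨(h k).1.trans (h' k).1,
    fun h₀ => ((h k).2 h₀).trans ((h' k).2 ((h k).1.symm.trans h₀))⟩

/-- `S` schedules the jobs that are not done in `c`. -/
def Completes (d : Fin n → Fin n → ℕ) (c : PartialSchedule n) (S : Fin n → ℝ) : Prop :=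
  (∀ k, c.done k = 0 → (c.start k : ℝ) ≤ S k) ∧
    ∀ j k, j ≠ k → c.done j = 0 → c.done k = 0 → S j + d j k ≤ S k ∨ S k + d j k ≤ S j

/-- The sum of the start times of the jobs that are not done. -/
def rest (c : PartialSchedule n) (S : Fin n → ℝ) : ℝ := ∑ k, if c.done k = 0 then S k else 0

theorem Completes.of_sameKey {d : Fin n → Fin n → ℕ} {c c' : PartialSchedule n} {S : Fin n → ℝ}
    (h : Completes d c S) (hk : SameKey c c') : Completes d c' S :=
  ⟨fun k hk' => (hk k).2 ((hk k).1.trans hk') ▸ h.1 k ((hk k).1.trans hk'),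
    fun j k hjk hj hk' => h.2 j k hjk ((hk j).1.trans hj) ((hk k).1.trans hk')⟩

theorem SameKey.rest_eq {c c' : PartialSchedule n} (h : SameKey c c') (S : Fin n → ℝ) :
    c.rest S = c'.rest S :=
  Finset.sum_congr rfl fun k _ => by rw [(h k).1]

/-- Exchange argument: any completion can be changed, without increasing its cost, so that an
eligible job comes first and starts at its earliest possible time. Restricting the search to
`Eligible` extensions thus loses no optimum. -/
theorem exists_eligible_extend {r : Fin n → ℕ} {d : Fin n → Fin n → ℕ} {c : PartialSchedule n}
    {S : Fin n → ℝ} (hd : ∀ j k, d j k = d k j)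
    (hmono : ∀ j k, c.done j = 0 → c.done k = 0 → d j = d k → r j ≤ r k → c.start j ≤ c.start k)
    (hS : Completes d c S) (hne : ∃ k, c.done k = 0) :
    ∃ j, Eligible r d c j ∧ ∃ S', Completes d (c.extend d j) S' ∧
      c.start j + (c.extend d j).rest S' ≤ c.rest S := by
  classical
  obtain ⟨k₀, hk₀⟩ := hne
  obtain ⟨i, hi, hmin⟩ := Finset.exists_min_image (Finset.univ.filter fun k => c.done k = 0) S
    ⟨k₀, by simpa using hk₀⟩
  -- `i` starts first in `S`, and `j` has the least priority in the row class of `i`; their start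
  -- times are exchanged.
  obtain ⟨j, hj, hprio⟩ := Finset.exists_min_image
    (Finset.univ.filter fun k => c.done k = 0 ∧ d k = d i) (priority r)
    ⟨i, by simpa using hi⟩
  simp only [Finset.mem_filter, Finset.mem_univ, true_and] at hi hmin hj hprio
  have hrow : ∀ a, d (Equiv.swap j i a) = d a := by
    intro a
    rcases eq_or_ne a j with rfl | h₁
    · rw [Equiv.swap_apply_left, hj.2]
    rcases eq_or_ne a i with rfl | h₂
    · rw [Equiv.swap_apply_right, hj.2]
    · rw [Equiv.swap_apply_of_ne_of_ne h₁ h₂]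
  -- Equality of rows handles the first argument; symmetry of `d` transfers it to the second.
  have hdist : ∀ a b, d (Equiv.swap j i a) (Equiv.swap j i b) = d a b := by
    intro a b
    rw [hrow, hd, hrow, hd]
  have hdone : ∀ a, c.done (Equiv.swap j i a) = 0 ↔ c.done a = 0 := by
    intro a
    rcases eq_or_ne a j with rfl | h₁
    · rw [Equiv.swap_apply_left]; simp [hi, hj.1]
    rcases eq_or_ne a i with rfl | h₂
    · rw [Equiv.swap_apply_right]; simp [hi, hj.1]
    · rw [Equiv.swap_apply_of_ne_of_ne h₁ h₂]
  have hij : c.start j ≤ c.start i :=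
    hmono j i hj.1 hi hj.2 (release_le_of_priority_le (hprio i ⟨hi, rfl⟩))
  have hstart : ∀ a, c.done a = 0 → (c.start a : ℝ) ≤ S (Equiv.swap j i a) := by
    intro a ha
    rcases eq_or_ne a j with rfl | h₁
    · rw [Equiv.swap_apply_left]
      exact (Nat.cast_le.2 hij).trans (hS.1 i hi)
    rcases eq_or_ne a i with rfl | h₂
    · rw [Equiv.swap_apply_right]
      exact (hS.1 a ha).trans (hmin j hj.1)
    · rw [Equiv.swap_apply_of_ne_of_ne h₁ h₂]; exact hS.1 a ha
  have hsep : ∀ a b, a ≠ b → c.done a = 0 → c.done b = 0 →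
      S (Equiv.swap j i a) + d a b ≤ S (Equiv.swap j i b) ∨
        S (Equiv.swap j i b) + d a b ≤ S (Equiv.swap j i a) := by
    intro a b hab ha hb
    have := hS.2 (Equiv.swap j i a) (Equiv.swap j i b) (fun h => hab (Equiv.injective _ h))
      ((hdone a).2 ha) ((hdone b).2 hb)
    rwa [hdist] at this
  refine ⟨j, ⟨hj.1, fun k hk hjk => hprio k ⟨hk, hjk.symm.trans hj.2⟩⟩,
    fun a => S (Equiv.swap j i a), ⟨fun k hk => ?_, fun a b hab ha hb => ?_⟩, ?_⟩
  · simp only [extend, Nat.add_eq_zero_iff, ite_eq_right_iff, one_ne_zero, imp_false] at hk ⊢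
    rw [if_pos hk, Nat.cast_max, Nat.cast_add]
    refine max_le (hstart k hk.1) ?_
    have h₁ := hstart j hj.1
    -- After the swap `j` starts no later than `k`. If `k` nevertheless precedes `j` by `d j k`, the
    -- distance is `0` and the starts coincide, so the bound still holds.
    rcases hsep j k (Ne.symm hk.2) hj.1 hk.1 with h | h
    · linarith
    · have h₂ := hmin _ ((hdone k).2 hk.1)
      simp only [Equiv.swap_apply_left] at h h₁ ⊢
      have h₃ : (0 : ℝ) ≤ d j k := Nat.cast_nonneg _
      linarith
  · simp only [extend, Nat.add_eq_zero_iff, ite_eq_right_iff, one_ne_zero, imp_false] at ha hb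
    exact hsep a b hab ha.1 hb.1
  -- The swap only permutes the summands. Splitting off the term of `j`, which is at least `c.start
  -- j`, gives the cost inequality.
  · have h₁ : c.rest S = ∑ k, if c.done k = 0 then S (Equiv.swap j i k) else 0 := by
      rw [rest, ← Equiv.sum_comp (Equiv.swap j i)]
      exact Finset.sum_congr rfl fun k _ => if_congr (hdone k) rfl rfl
    have h₂ : (∑ k, if c.done k = 0 then S (Equiv.swap j i k) else 0) =
        (∑ k, if k = j then S (Equiv.swap j i k) else 0) +
          (c.extend d j).rest fun a => S (Equiv.swap j i a) := by
      rw [rest, ← Finset.sum_add_distrib]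
      refine Finset.sum_congr rfl fun k _ => ?_
      rcases eq_or_ne k j with rfl | h
      · simp [extend, hj.1]
      · simp [extend, h]
    rw [h₁, h₂, Finset.sum_ite_eq' Finset.univ j]
    have := hstart j hj.1
    simpa using this

/-- The properties of the partial schedules that are reached after `l` steps. -/
structure Valid (r : Fin n → ℕ) (d : Fin n → Fin n → ℕ) (p q l : ℕ) (c : PartialSchedule n) :
    Prop where
  sum_done : ∑ k, c.done k = l
  cost_eq : c.cost = ∑ k, c.done k * c.start k
  release_le : ∀ k, r k ≤ c.start k
  separated : ∀ j k, j ≠ k → c.done j ≠ 0 → c.done k ≠ 0 →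
    c.start j + d j k ≤ c.start k ∨ c.start k + d j k ≤ c.start j
  ready : ∀ j k, c.done j ≠ 0 → c.done k = 0 → c.start j + d j k ≤ c.start k
  mem_candidates : ∀ k, c.start k ∈ candidates r p q l
  -- The compressed state: per row, a threshold for the priorities of the jobs that are done and a
  -- common lower bound for the starts of the others. Indexing by the row `d k` itself expresses
  -- that jobs with equal rows share both numbers.
  exists_code : ∃ f : (Fin n → ℕ) → ℕ × ℕ, ∀ k,
    (f (d k)).1 ∈ thresholds r ∧ (f (d k)).2 ∈ candidates r p q l ∧
    (c.done k = if priority r k < (f (d k)).1 then 1 else 0) ∧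
    (c.done k = 0 → c.start k = max (r k) (f (d k)).2)

theorem Valid.done_le_one {r : Fin n → ℕ} {d : Fin n → Fin n → ℕ} {p q l : ℕ}
    {c : PartialSchedule n} (h : Valid r d p q l c) (k : Fin n) : c.done k ≤ 1 := by
  obtain ⟨f, hf⟩ := h.exists_code
  rw [(hf k).2.2.1]
  split_ifs <;> simp

theorem Valid.start_mono {r : Fin n → ℕ} {d : Fin n → Fin n → ℕ} {p q l : ℕ}
    {c : PartialSchedule n} (h : Valid r d p q l c) (j k : Fin n) (hj : c.done j = 0)
    (hk : c.done k = 0) (hjk : d j = d k) (hr : r j ≤ r k) : c.start j ≤ c.start k := by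
  obtain ⟨f, hf⟩ := h.exists_code
  rw [(hf k).2.2.2 hk, (hf j).2.2.2 hj, hjk]
  exact max_le_max hr le_rfl

theorem Valid.exists_not_done {r : Fin n → ℕ} {d : Fin n → Fin n → ℕ} {p q l : ℕ}
    {c : PartialSchedule n} (h : Valid r d p q l c) (hl : l < n) : ∃ k, c.done k = 0 := by
  by_contra! hne
  have : ∑ _k : Fin n, 1 ≤ ∑ k, c.done k :=
    Finset.sum_le_sum fun k _ => Nat.one_le_iff_ne_zero.2 (hne k)
  rw [h.sum_done] at this
  simp at this
  omega

theorem Valid.done_eq_one {r : Fin n → ℕ} {d : Fin n → Fin n → ℕ} {p q : ℕ}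
    {c : PartialSchedule n} (h : Valid r d p q n c) (k : Fin n) : c.done k = 1 := by
  by_contra hk
  have : ∑ k, c.done k < ∑ _k : Fin n, 1 :=
    Finset.sum_lt_sum (fun k _ => h.done_le_one k)
      ⟨k, Finset.mem_univ k, lt_of_le_of_ne (h.done_le_one k) hk⟩
  rw [h.sum_done] at this
  simp at this

theorem valid_empty (r : Fin n → ℕ) (d : Fin n → Fin n → ℕ) (p q : ℕ) :
    Valid r d p q 0 (empty r) where
  sum_done := by simp [empty]
  cost_eq := by simp [empty]
  release_le k := le_rfl
  separated := by simp [empty]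
  ready := by simp [empty]
  mem_candidates k := release_mem_candidates r p q 0 k
  exists_code := ⟨fun _ => (0, 0), fun k => ⟨by simp [thresholds], by simp [candidates],
    by simp [empty], by simp [empty]⟩⟩

/-- Fixing `j` raises the threshold of its own row just past `j`, and raises the bound of a row `x`
to at least `c.start j + x j`. By symmetry of `d` the delay caused by `j` depends only on the row of
the delayed job, so the compressed form survives. -/
theorem Valid.extend {r : Fin n → ℕ} {d : Fin n → Fin n → ℕ} {p q l : ℕ} {c : PartialSchedule n}
    {j : Fin n} (hd : ∀ j k, d j k = d k j) (hpq : ∀ j k, d j k = 0 ∨ d j k = p ∨ d j k = q)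
    (h : Valid r d p q l c) (hj : Eligible r d c j) : Valid r d p q (l + 1) (c.extend d j) := by
  classical
  obtain ⟨f, hf⟩ := h.exists_code
  have hstart : ∀ k, c.done k ≠ 0 ∨ k = j → (c.extend d j).start k = c.start k := by
    intro k hk
    simp only [PartialSchedule.extend]
    rw [if_neg]
    tauto
  have hstart' : ∀ k, c.done k = 0 → k ≠ j →
      (c.extend d j).start k = max (c.start k) (c.start j + d j k) := by
    intro k hk hkj
    simp only [PartialSchedule.extend]
    rw [if_pos ⟨hk, hkj⟩]
  have hdone : ∀ k, (c.extend d j).done k = c.done k + if k = j then 1 else 0 := fun _ => rfl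
  have hdone₀ : ∀ k, (c.extend d j).done k = 0 ↔ c.done k = 0 ∧ k ≠ j := by
    intro k
    rw [hdone]
    split_ifs with hk <;> simp [hk]
  have hdone₁ : ∀ k, (c.extend d j).done k ≠ 0 ↔ c.done k ≠ 0 ∨ k = j := by
    intro k
    rw [ne_eq, hdone₀]
    tauto
  have hle : ∀ k, c.start k ≤ (c.extend d j).start k := by
    intro k
    by_cases hk : c.done k = 0 ∧ k ≠ j
    · rw [hstart' k hk.1 hk.2]; exact le_max_left _ _
    · rw [hstart k (by tauto)]
  have hsj : c.start j = max (r j) (f (d j)).2 := (hf j).2.2.2 hj.1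
  have hnew : ∀ k, c.start j + d j k ∈ candidates r p q (l + 1) := by
    intro k
    rw [hsj]
    exact max_release_add_mem_candidates j (hf j).2.1 (hpq j k)
  refine ⟨?_, ?_, fun k => (h.release_le k).trans (hle k), ?_, ?_, ?_, ?_⟩
  · simp only [hdone, Finset.sum_add_distrib, h.sum_done, Finset.sum_ite_eq', Finset.mem_univ,
      if_true]
  -- Starts of jobs that remain open may move, but their flag `0` removes them from the sum.
  · have : ∀ k, (c.extend d j).done k * (c.extend d j).start k =
        c.done k * c.start k + if k = j then c.start k else 0 := by
      intro k
      by_cases hk : c.done k = 0 ∧ k ≠ j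
      · rw [(hdone₀ k).2 hk]
        simp [hk.1, hk.2]
      · rw [hstart k (by tauto), hdone]
        split_ifs <;> ring
    simp only [this, Finset.sum_add_distrib, ← h.cost_eq, Finset.sum_ite_eq', Finset.mem_univ,
      if_true]
    rfl
  · intro a b hab ha hb
    rw [hdone₁] at ha hb
    rw [hstart a ha, hstart b hb]
    rcases ha with ha | rfl
    · rcases hb with hb | rfl
      · exact h.separated a b hab ha hb
      · exact .inl (h.ready a b ha hj.1)
    · rcases hb with hb | rfl
      · rw [hd]; exact .inr (h.ready b a hb hj.1)
      · exact absurd rfl hab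
  · intro a b ha hb
    rw [hdone₁] at ha
    rw [hdone₀] at hb
    rw [hstart a ha, hstart' b hb.1 hb.2]
    rcases ha with ha | rfl
    · exact (h.ready a b ha hb.1).trans (le_max_left _ _)
    · exact le_max_right _ _
  · intro k
    by_cases hk : c.done k = 0 ∧ k ≠ j
    · rw [hstart' k hk.1 hk.2]
      rcases max_choice (c.start k) (c.start j + d j k) with e | e <;> rw [e]
      · exact candidates_mono l.le_succ (h.mem_candidates k)
      · exact hnew k
    · rw [hstart k (by tauto)]
      exact candidates_mono l.le_succ (h.mem_candidates k)
  · refine ⟨fun x => (if x = d j then priority r j + 1 else (f x).1,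
      max (f x).2 (c.start j + x j)), fun k => ⟨?_, ?_, ?_, ?_⟩⟩
    · dsimp only
      split_ifs
      · simp [thresholds]
      · exact (hf k).1
    · dsimp only
      rcases max_choice (f (d k)).2 (c.start j + d k j) with e | e <;> rw [e]
      · exact candidates_mono l.le_succ (hf k).2.1
      · rw [hd]; exact hnew k
    · have hk := (hf k).2.2.1
      dsimp only
      by_cases hkj : d k = d j
      · simp only [if_pos hkj, hdone]
        by_cases hkj' : k = j
        · subst hkj'
          simp [hj.1]
        · have hne : priority r k ≠ priority r j := fun e => hkj' (priority_injective r e)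
          -- As `j` was open, the old threshold is at most its priority. As `j` is least among the
          -- open jobs of its row, the new threshold adds `j` and nothing else.
          have hjthr : (f (d j)).1 ≤ priority r j := by
            have := (hf j).2.2.1
            rw [hj.1] at this
            by_contra! hlt
            rw [if_pos hlt] at this
            omega
          rw [hkj] at hk
          by_cases hk₀ : c.done k = 0
          · have := hj.2 k hk₀ hkj.symm
            rw [if_neg hkj', if_neg (by omega), hk₀]
          · have : priority r k < (f (d j)).1 := by
              by_contra hlt
              rw [if_neg hlt] at hk
              exact hk₀ hk
            rw [if_neg hkj', if_pos (by omega), hk, if_pos this]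
      · simp only [if_neg hkj, hdone]
        rw [if_neg (fun e => hkj (by rw [e])), ← hk, add_zero]
    · intro hk
      rw [hdone₀] at hk
      rw [hstart' k hk.1 hk.2, (hf k).2.2.2 hk.1, hd j k, max_assoc]

/-- The code, restricted to the rows that occur, determines the completion key. Pairwise different
keys therefore inject into the functions from rows to pairs (threshold, candidate). -/
theorem card_le_of_valid {ι : Type*} {r : Fin n → ℕ} {d : Fin n → Fin n → ℕ} {p q l : ℕ}
    (s : Finset ι) (c : ι → PartialSchedule n) (hl : l ≤ n)
    (hv : ∀ i ∈ s, Valid r d p q l (c i))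
    (hs : ∀ i ∈ s, ∀ i' ∈ s, SameKey (c i) (c i') → i = i') :
    s.card ≤ ((n + 1) * (n * (n + 1) ^ 2 + 1)) ^ (Finset.univ.image d).card := by
  classical
  have hex : ∀ i, ∃ f : (Fin n → ℕ) → ℕ × ℕ, i ∈ s → ∀ k,
    (f (d k)).1 ∈ thresholds r ∧ (f (d k)).2 ∈ candidates r p q l ∧
    ((c i).done k = if priority r k < (f (d k)).1 then 1 else 0) ∧
    ((c i).done k = 0 → (c i).start k = max (r k) (f (d k)).2) := by
    intro i
    by_cases hi : i ∈ s
    · obtain ⟨f, hf⟩ := (hv i hi).exists_code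
      exact ⟨f, fun _ => hf⟩
    -- Outside `s` the code is a dummy value that is never used.
    · exact ⟨fun _ => (0, 0), fun h => absurd h hi⟩
  choose f hf using hex
  let t : Finset ({x // x ∈ Finset.univ.image d} → ℕ × ℕ) :=
    Fintype.piFinset fun _ => thresholds r ×ˢ candidates r p q l
  have hcard : s.card ≤ t.card := by
    refine Finset.card_le_card_of_injOn (fun i x => f i x.1) ?_ ?_
    · intro i hi
      simp only [t, Finset.mem_coe, Fintype.mem_piFinset, Finset.mem_product]
      rintro ⟨x, hx⟩
      obtain ⟨k, -, rfl⟩ := Finset.mem_image.1 hx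
      exact ⟨(hf i hi k).1, (hf i hi k).2.1⟩
    · intro i hi i' hi' h
      have hfk : ∀ k, f i (d k) = f i' (d k) := fun k =>
        congrFun h ⟨d k, Finset.mem_image_of_mem d (Finset.mem_univ k)⟩
      refine hs i hi i' hi' fun k => ?_
      have h₁ := (hf i hi k).2.2
      have h₂ := (hf i' hi' k).2.2
      rw [← hfk] at h₂
      have h₃ := h₁.1.trans h₂.1.symm
      exact ⟨h₃, fun h₀ => (h₁.2 h₀).trans (h₂.2 (h₃.symm.trans h₀)).symm⟩
  refine hcard.trans ?_
  simp only [t]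
  rw [Fintype.card_piFinset, Finset.prod_const, Finset.card_univ, Finset.card_product,
    Fintype.card_coe]
  refine Nat.pow_le_pow_left (Nat.mul_le_mul (card_thresholds_le r)
    ((card_candidates_le r p q l).trans ?_)) _
  gcongr

end PartialSchedule
end BidirScheduling

namespace BidirScheduling

/-! ### Programs that work on two-dimensional arrays -/

/-- The names of the arrays and variables of the scheduling program. A variable is an array of which
only entry `(0, 0)` is used. -/
inductive Var : Type
  | done | start | cost | newDone | newStart | newCost
  | lo | hi | len | layer | cur | job | k | l | i | acc | bad | pos
  deriving DecidableEq

/-- The number of an array. -/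
def Var.code : Var → ℕ
  | done => 0 | start => 1 | cost => 2 | newDone => 3 | newStart => 4 | newCost => 5
  | lo => 6 | hi => 7 | len => 8 | layer => 9 | cur => 10 | job => 11 | k => 12 | l => 13 | i => 14
  | acc => 15 | bad => 16 | pos => 17

theorem Var.code_injective : Function.Injective Var.code := by
  intro a b h
  cases a <;> cases b <;> first | rfl | (exfalso; revert h; decide)

/-- An injective pairing function without division or case distinction. -/
def pairing (i j : ℕ) : ℕ := (i + j) * (i + j) + i

/-- With `t = i + j`, the value lies between `t ^ 2` and `t ^ 2 + t`, hence below `(t + 1) ^ 2`. So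
it determines `t`, and then `i`. -/
theorem pairing_inj {i j i' j' : ℕ} : pairing i j = pairing i' j' ↔ i = i' ∧ j = j' := by
  constructor
  · intro h
    unfold pairing at h
    have h₁ : i + j = i' + j' := by
      rcases lt_trichotomy (i + j) (i' + j') with hlt | heq | hlt
      · have := Nat.mul_le_mul (Nat.succ_le_of_lt hlt) (Nat.succ_le_of_lt hlt)
        simp only [Nat.succ_mul, Nat.mul_succ] at this
        omega
      · exact heq
      · have := Nat.mul_le_mul (Nat.succ_le_of_lt hlt) (Nat.succ_le_of_lt hlt)
        simp only [Nat.succ_mul, Nat.mul_succ] at this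
        omega
    rw [h₁] at h
    omega
  · rintro ⟨rfl, rfl⟩
    rfl

/-- The memory cell that holds entry `(i, j)` of array `a`. -/
def address (a : Var) (i j : ℕ) : ℕ := pairing a.code (pairing i j)

theorem address_inj {a a' : Var} {i j i' j' : ℕ} :
    address a i j = address a' i' j' ↔ a = a' ∧ i = i' ∧ j = j' := by
  unfold address
  rw [pairing_inj, pairing_inj, Var.code_injective.eq_iff]

namespace State

/-- Entry `(i, j)` of array `a`. -/
def get (s : State) (a : Var) (i j : ℕ) : ℕ := s.mem (address a i j)

/-- Set entry `(i, j)` of array `a` to `v`. -/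
def put (s : State) (a : Var) (i j v : ℕ) : State :=
  ⟨Function.update s.mem (address a i j) v, s.out⟩

@[simp] theorem get_put (s : State) (a a' : Var) (i j i' j' v : ℕ) :
    (s.put a i j v).get a' i' j' = if a' = a ∧ i' = i ∧ j' = j then v else s.get a' i' j' := by
  simp only [get, put, Function.update_apply, address_inj]

@[simp] theorem out_put (s : State) (a : Var) (i j v : ℕ) : (s.put a i j v).out = s.out := rfl

/-- `s'` differs from `s` only in the arrays in `A`. -/
def Frame (A : List Var) (s s' : State) : Prop :=
  s'.out = s.out ∧ ∀ a, a ∉ A → ∀ i j, s'.get a i j = s.get a i j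

theorem Frame.refl (A : List Var) (s : State) : Frame A s s := ⟨rfl, fun _ _ _ _ => rfl⟩

theorem Frame.trans {A : List Var} {s s' s'' : State} (h : Frame A s s') (h' : Frame A s' s'') :
    Frame A s s'' :=
  ⟨h'.1.trans h.1, fun a ha i j => (h'.2 a ha i j).trans (h.2 a ha i j)⟩

theorem Frame.mono {A B : List Var} {s s' : State} (h : Frame A s s') (hAB : A ⊆ B) :
    Frame B s s' :=
  ⟨h.1, fun a ha i j => h.2 a (fun h' => ha (hAB h')) i j⟩

theorem Frame.put {A : List Var} {s s' : State} (h : Frame A s s') {a : Var} (ha : a ∈ A)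
    (i j v : ℕ) : Frame A s (s'.put a i j v) := by
  refine ⟨h.1, fun b hb i' j' => ?_⟩
  rw [get_put, if_neg (by rintro ⟨rfl, -⟩; exact hb ha), h.2 b hb]

end State

/-! ### Expressions for array access, and bounds on their values and costs. -/

namespace Expr

/-- The address of entry `(e, f)` of array `a`. -/
def cell (a : Var) (e f : Expr) : Expr :=
  let g := add (mul (add e f) (add e f)) e
  add (mul (add (const a.code) g) (add (const a.code) g)) (const a.code)

/-- Entry `(e, f)` of array `a`. -/
def arr (a : Var) (e f : Expr) : Expr := mem (cell a e f)

/-- The value of a variable. -/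
def var (a : Var) : Expr := arr a (const 0) (const 0)

@[simp] theorem eval_arr (x : List ℕ) (s : State) (a : Var) (e f : Expr) :
    (arr a e f).eval x s.mem = s.get a (e.eval x s.mem) (f.eval x s.mem) := rfl

@[simp] theorem eval_var (x : List ℕ) (s : State) (a : Var) :
    (var a).eval x s.mem = s.get a 0 0 := rfl

@[simp] theorem eval_const (x : List ℕ) (M : ℕ → ℕ) (k : ℕ) : (const k).eval x M = k := rfl

@[simp] theorem eval_input (x : List ℕ) (M : ℕ → ℕ) (e : Expr) :
    (input e).eval x M = x.getD (e.eval x M) 0 := rfl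

@[simp] theorem eval_add (x : List ℕ) (M : ℕ → ℕ) (e f : Expr) :
    (add e f).eval x M = e.eval x M + f.eval x M := rfl

@[simp] theorem eval_sub (x : List ℕ) (M : ℕ → ℕ) (e f : Expr) :
    (sub e f).eval x M = e.eval x M - f.eval x M := rfl

@[simp] theorem eval_mul (x : List ℕ) (M : ℕ → ℕ) (e f : Expr) :
    (mul e f).eval x M = e.eval x M * f.eval x M := rfl

/-- If memory and input are bounded by `M`, then the value of `e` is at most `M ^ degree e`. -/
def degree : Expr → ℕ
  | const k => k + 1
  | input _ => 1
  | mem _ => 1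
  | add e f => e.degree + f.degree
  | sub e _ => e.degree
  | mul e f => e.degree + f.degree

/-- If memory and input are bounded by `M`, then the cost of evaluating `e` is at most `weight e`
times the length of `M`. -/
def weight : Expr → ℕ
  | const k => k + 2
  | input e => e.weight + 2
  | mem e => e.weight + 2
  | add e f => e.weight + f.weight + (e.degree + f.degree + 1)
  | sub e f => e.weight + f.weight + (e.degree + 1)
  | mul e f => e.weight + f.weight + (e.degree + f.degree + 1)

theorem degree_pos (e : Expr) : 0 < e.degree := by
  induction e <;> simp only [degree] <;> omega

end Expr

/-- The entries of the input are at most `M`. -/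
def Fits (x : List ℕ) (M : ℕ) : Prop := 2 ≤ M ∧ ∀ i, x.getD i 0 ≤ M

/-- Intermediate values such as addresses may exceed `M`, but the exponent depends on the expression
only. -/
theorem Expr.eval_le {x : List ℕ} {M : ℕ} (hx : Fits x M) {m : ℕ → ℕ} (hm : ∀ a, m a ≤ M)
    (e : Expr) : e.eval x m ≤ M ^ e.degree := by
  have hle : ∀ e : Expr, 2 ≤ M ^ e.degree := fun e =>
    hx.1.trans (Nat.le_self_pow e.degree_pos.ne' M)
  induction e with
  | const k =>
    -- A constant `k` is at most `2 ^ (k + 1)`, hence at most `M ^ (k + 1)` because `2 ≤ M`.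
    exact (Nat.lt_two_pow_self.le.trans (Nat.pow_le_pow_right two_pos k.le_succ)).trans
      (Nat.pow_le_pow_left hx.1 _)
  | input e _ => simpa [degree] using hx.2 _
  | mem e _ => simpa [degree, eval] using hm _
  | add e f ihe ihf =>
    simp only [degree, eval_add, pow_add]
    have h₁ := hle e
    have h₂ := hle f
    nlinarith
  | sub e f ihe _ => exact (Nat.sub_le _ _).trans ihe
  | mul e f ihe ihf =>
    simp only [degree, eval_mul, pow_add]
    exact Nat.mul_le_mul ihe ihf

/-- From `M < 2 ^ M.size` the value has at most `e * M.size` bits; one further `M.size` pays for the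
separator. -/
theorem bitLength_le {v M e : ℕ} (hM : 2 ≤ M) (he : 0 < e) (h : v ≤ M ^ e) :
    bitLength v ≤ (e + 1) * M.size := by
  have h₁ : 1 ≤ M.size := Nat.size_pos.2 (by omega)
  have h₂ : v.size ≤ e * M.size := by
    refine Nat.size_le.2 (h.trans_lt ?_)
    rw [mul_comm, pow_mul]
    exact Nat.pow_lt_pow_left (Nat.lt_size_self M) he.ne'
  rw [bitLength, add_mul]
  omega

theorem Expr.cost_le {x : List ℕ} {M : ℕ} (hx : Fits x M) {m : ℕ → ℕ} (hm : ∀ a, m a ≤ M)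
    (e : Expr) : e.cost x m ≤ e.weight * M.size := by
  induction e with
  | const k => exact bitLength_le hx.1 (const k).degree_pos (eval_le hx hm (const k))
  | input e ih =>
    have := bitLength_le hx.1 (degree_pos _) (eval_le hx hm (input e))
    simp only [degree, weight, cost, add_mul] at *
    omega
  | mem e ih =>
    have := bitLength_le hx.1 (degree_pos _) (eval_le hx hm (mem e))
    simp only [degree, weight, cost, add_mul] at *
    omega
  | add e f ihe ihf =>
    have := bitLength_le hx.1 (degree_pos _) (eval_le hx hm (add e f))
    simp only [degree, weight, cost, add_mul] at *
    omega
  | sub e f ihe ihf =>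
    have := bitLength_le hx.1 (degree_pos _) (eval_le hx hm (sub e f))
    simp only [degree, weight, cost, add_mul] at *
    omega
  | mul e f ihe ihf =>
    have := bitLength_le hx.1 (degree_pos _) (eval_le hx hm (mul e f))
    simp only [degree, weight, cost, add_mul] at *
    omega

/-! ### A program logic with step counts. -/

namespace Prog

/-- A bound on the cost of one step of the program, in units of the length of the numbers. -/
def weight : Prog → ℕ
  | skip => 1
  | store a e => a.weight + e.weight + 1
  | write e => e.weight + 1
  | seq c d => c.weight + d.weight + 1
  | ite e c d => e.weight + c.weight + d.weight + 1
  | .while e c => e.weight + c.weight + 1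

/-- Assign the value of `g` to entry `(e, f)` of array `a`. -/
def assign (a : Var) (e f g : Expr) : Prog := store (Expr.cell a e f) g

/-- Assign the value of `g` to a variable. -/
def set (a : Var) (g : Expr) : Prog := assign a (.const 0) (.const 0) g

/-- Run `c` for all values of the variable `v` from `e₀` to `e - 1`. -/
def loop (v : Var) (e₀ e : Expr) (c : Prog) : Prog :=
  seq (set v e₀) (.while (.sub e (.var v)) (seq c (set v (.add (.var v) (.const 1)))))

end Prog

/-- Started in state `s` with memory bounded by `M`, the program `c` halts after at most `n` steps,
all values stored are at most `M`, and the final state has property `Q`. -/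
def Runs (x : List ℕ) (M : ℕ) (c : Prog) (s : State) (n : ℕ) (Q : State → Prop) : Prop :=
  (∀ a, s.mem a ≤ M) → ∃ t s', Exec x c s t s' ∧ t ≤ n * (c.weight * M.size) ∧
    (∀ a, s'.mem a ≤ M) ∧ Q s'

namespace Runs

open BidirScheduling.Expr

variable {x : List ℕ} {M : ℕ}

theorem mono {c : Prog} {s : State} {n n' : ℕ} {Q : State → Prop} (h : Runs x M c s n Q)
    (hn : n ≤ n') : Runs x M c s n' Q := fun hs =>
  let ⟨t, s', h₁, h₂, h₃⟩ := h hs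
  ⟨t, s', h₁, h₂.trans (Nat.mul_le_mul_right _ hn), h₃⟩

theorem imp {c : Prog} {s : State} {n : ℕ} {Q Q' : State → Prop} (h : Runs x M c s n Q)
    (hQ : ∀ s', Q s' → Q' s') : Runs x M c s n Q' := fun hs =>
  let ⟨t, s', h₁, h₂, h₃, h₄⟩ := h hs
  ⟨t, s', h₁, h₂, h₃, hQ s' h₄⟩

theorem skip (hx : Fits x M) {s : State} {Q : State → Prop} (h : Q s) :
    Runs x M Prog.skip s 1 Q := fun hs =>
  ⟨1, s, .skip s, by
    have : 1 ≤ M.size := Nat.size_pos.2 (by have := hx.1; omega)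
    simpa [Prog.weight] using this, hs, h⟩

theorem assign (hx : Fits x M) {a : Var} {e f g : Expr} {s : State} {Q : State → Prop}
    (hg : g.eval x s.mem ≤ M)
    (h : Q (s.put a (e.eval x s.mem) (f.eval x s.mem) (g.eval x s.mem))) :
    Runs x M (Prog.assign a e f g) s 1 Q := fun hs => by
  refine ⟨_, _, .store _ _ s, ?_, fun b => ?_, h⟩
  · have h₁ := (cell a e f).cost_le hx hs
    have h₂ := g.cost_le hx hs
    have h₃ : 1 ≤ M.size := Nat.size_pos.2 (by have := hx.1; omega)
    simp only [Prog.assign, Prog.weight, add_mul, one_mul]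
    omega
  · simp only [Function.update_apply]
    split_ifs
    exacts [hg, hs b]

theorem set (hx : Fits x M) {a : Var} {g : Expr} {s : State} {Q : State → Prop}
    (hg : g.eval x s.mem ≤ M) (h : Q (s.put a 0 0 (g.eval x s.mem))) :
    Runs x M (Prog.set a g) s 1 Q :=
  assign hx hg h

theorem write (hx : Fits x M) {e : Expr} {s : State} {Q : State → Prop}
    (h : Q ⟨s.mem, s.out ++ [e.eval x s.mem]⟩) : Runs x M (Prog.write e) s 1 Q := fun hs => by
  refine ⟨_, _, .write _ s, ?_, hs, h⟩
  have h₂ := e.cost_le hx hs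
  have h₃ : 1 ≤ M.size := Nat.size_pos.2 (by have := hx.1; omega)
  simp only [Prog.weight, add_mul, one_mul]
  omega

/-- The weight of the composition exceeds both weights, so step counts simply add; the extra unit of
cost is charged to the first part, which is why `0 < n` is needed. -/
theorem seq {c d : Prog} {s : State} {n n' : ℕ} {Q : State → Prop} (hM : 0 < M) (hn : 0 < n)
    (h : Runs x M c s n fun s' => Runs x M d s' n' Q) :
    Runs x M (Prog.seq c d) s (n + n') Q := fun hs => by
  obtain ⟨t, s', h₁, h₂, h₃, h₄⟩ := h hs
  obtain ⟨t', s'', g₁, g₂, g₃, g₄⟩ := h₄ h₃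
  refine ⟨_, _, .seq h₁ g₁, ?_, g₃, g₄⟩
  have h₅ : 1 ≤ M.size := Nat.size_pos.2 hM
  have h₆ : 1 ≤ n * M.size := Nat.mul_pos hn h₅
  calc t + t' + 1 ≤ n * (c.weight * M.size) + n' * (d.weight * M.size) + n * M.size := by omega
    _ ≤ n * (c.weight * M.size) + n' * (d.weight * M.size) + n * M.size +
        (n * (d.weight * M.size) + n' * (c.weight * M.size) + n' * M.size) := Nat.le_add_right _ _
    _ = _ := by simp only [Prog.weight]; ring

theorem ite (hx : Fits x M) {e : Expr} {c d : Prog} {s : State} {n : ℕ} {Q : State → Prop}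
    (h₁ : e.eval x s.mem ≠ 0 → Runs x M c s n Q) (h₀ : e.eval x s.mem = 0 → Runs x M d s n Q) :
    Runs x M (Prog.ite e c d) s (n + 1) Q := fun hs => by
  have he := e.cost_le hx hs
  have h₅ : 1 ≤ M.size := Nat.size_pos.2 (by have := hx.1; omega)
  by_cases h : e.eval x s.mem = 0
  · obtain ⟨t, s', g₁, g₂, g₃⟩ := h₀ h hs
    refine ⟨_, _, .ite_false h g₁, ?_, g₃⟩
    calc e.cost x s.mem + t + 1
        ≤ e.weight * M.size + n * (d.weight * M.size) + M.size := by omega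
      _ ≤ e.weight * M.size + n * (d.weight * M.size) + M.size +
        (n * (e.weight * M.size) + n * M.size + (n + 1) * (c.weight * M.size) +
          d.weight * M.size) := Nat.le_add_right _ _
      _ = _ := by simp only [Prog.weight]; ring
  · obtain ⟨t, s', g₁, g₂, g₃⟩ := h₁ h hs
    refine ⟨_, _, .ite_true h g₁, ?_, g₃⟩
    calc e.cost x s.mem + t + 1
        ≤ e.weight * M.size + n * (c.weight * M.size) + M.size := by omega
      _ ≤ e.weight * M.size + n * (c.weight * M.size) + M.size +
        (n * (e.weight * M.size) + n * M.size + (n + 1) * (d.weight * M.size) +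
          c.weight * M.size) := Nat.le_add_right _ _
      _ = _ := by simp only [Prog.weight]; ring

theorem while_false (hx : Fits x M) {e : Expr} {c : Prog} {s : State} {Q : State → Prop}
    (he : e.eval x s.mem = 0) (h : Q s) : Runs x M (Prog.while e c) s 1 Q := fun hs => by
  refine ⟨_, _, .while_false he, ?_, hs, h⟩
  have h₁ := e.cost_le hx hs
  have h₅ : 1 ≤ M.size := Nat.size_pos.2 (by have := hx.1; omega)
  simp only [Prog.weight, add_mul, one_mul]
  omega

theorem while_true (hx : Fits x M) {e : Expr} {c : Prog} {s : State} {n n' : ℕ}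
    {Q : State → Prop} (he : e.eval x s.mem ≠ 0)
    (h : Runs x M c s n fun s' => Runs x M (Prog.while e c) s' n' Q) :
    Runs x M (Prog.while e c) s (n + n' + 1) Q := fun hs => by
  have h₁ := e.cost_le hx hs
  have h₅ : 1 ≤ M.size := Nat.size_pos.2 (by have := hx.1; omega)
  obtain ⟨t, s', g₁, g₂, g₃, g₄⟩ := h hs
  obtain ⟨t', s'', k₁, k₂, k₃⟩ := g₄ g₃
  refine ⟨_, _, .while_true he g₁ k₁, ?_, k₃⟩
  simp only [Prog.weight] at *
  calc e.cost x s.mem + t + t' + 1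
      ≤ e.weight * M.size + n * (c.weight * M.size) +
        n' * ((e.weight + c.weight + 1) * M.size) + M.size := by omega
    _ ≤ e.weight * M.size + n * (c.weight * M.size) +
        n' * ((e.weight + c.weight + 1) * M.size) + M.size +
        (n * (e.weight * M.size) + n * M.size + c.weight * M.size) := Nat.le_add_right _ _
    _ = _ := by ring

/-- Rule for loops with invariant `P`. -/
theorem loop (hx : Fits x M) {v : Var} {e₀ e : Expr} {c : Prog} {s : State} {m a b : ℕ}
    {Q : State → Prop} (P : ℕ → State → Prop) (hab : a ≤ b) (hb : b ≤ M)
    (ha : e₀.eval x s.mem = a) (hinit : P a (s.put v 0 0 a))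
    (hbound : ∀ i s', P i s' → e.eval x s'.mem = b)
    (hstep : ∀ i s', a ≤ i → i < b → P i s' → s'.get v 0 0 = i →
      Runs x M c s' m fun s'' => s''.get v 0 0 = i ∧ P (i + 1) (s''.put v 0 0 (i + 1)))
    (hexit : ∀ s', P b s' → Q s') :
    Runs x M (Prog.loop v e₀ e c) s ((b - a) * (m + 3) + 2) Q := by
  have hM : 0 < M := by have := hx.1; omega
  -- Induction on the number `k` of remaining iterations. Each one costs the body, the increment and
  -- the test; `m + 3` leaves one spare step.
  have main : ∀ k i s', i + k = b → a ≤ i → P i s' → s'.get v 0 0 = i →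
      Runs x M (.while (.sub e (.var v)) (.seq c (Prog.set v (.add (.var v) (.const 1))))) s'
        (k * (m + 3) + 1) Q := by
    intro k
    induction k with
    | zero =>
      intro i s' hi _ hP hv
      have hib : i = b := by omega
      subst hib
      refine (while_false hx ?_ (hexit s' hP)).mono (by omega)
      simp [hbound _ _ hP, hv]
    | succ k ih =>
      intro i s' hi hai hP hv
      have hstep' := hstep i s' hai (by omega) hP hv
      refine (while_true hx (n := m + 1 + 1) (n' := k * (m + 3) + 1) ?_ ?_).mono ?_
      · simp [hbound _ _ hP, hv]; omega
      -- The spare step makes the count of the body positive even if `m = 0`.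
      · refine seq hM (Nat.succ_pos _) ((hstep'.mono m.le_succ).imp ?_)
        rintro s'' ⟨hv', hP'⟩
        refine set hx ?_ ?_
        · simp [hv']; omega
        · simp only [eval_add, eval_var, eval_const, hv']
          exact ih (i + 1) _ (by omega) (by omega) hP' (by simp)
      · rw [Nat.succ_mul]; omega
  have hfirst := main (b - a) a _ (by omega) le_rfl hinit (by simp)
  refine (seq hM one_pos (set hx (by omega) (by rwa [ha]))).mono ?_
  omega

end Runs
end BidirScheduling

namespace BidirScheduling

/-! ### The program -/

namespace Expr

/-- `0` if the values of `e` and `f` agree, and `1` otherwise. -/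
def differ (e f : Expr) : Expr := sub (const 1) (sub (const 1) (add (sub e f) (sub f e)))

@[simp] theorem eval_differ (x : List ℕ) (m : ℕ → ℕ) (e f : Expr) :
    (differ e f).eval x m = if e.eval x m = f.eval x m then 0 else 1 := by
  simp only [differ, eval_sub, eval_add, eval_const]
  split_ifs <;> omega

/-- The number of jobs. -/
def num : Expr := input (const 1)

/-- The release date of job `j`. -/
def release (j : Expr) : Expr := input (add (const 4) (mul (const 5) j))

/-- The priority value of job `j`. -/
def prio (j : Expr) : Expr := add (mul (release j) num) j

/-- The direction of job `j`. -/
def direction (j : Expr) : Expr := input (add (const 3) (mul (const 5) j))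

/-- The entry of the adjacency matrix of the compatibility graph. -/
def adjacent (j k : Expr) : Expr :=
  input (add (add (const 3) (mul (const 5) num)) (add (mul num j) k))

/-- The minimum distance between the start times of the jobs `j` and `k`. -/
def dist (j k : Expr) : Expr :=
  mul (sub (const 1) (add (adjacent j k) (adjacent k j)))
    (add (input (add (const 5) (mul (const 5) j)))
      (mul (differ (direction j) (direction k)) (input (const 2))))

end Expr

/-- The input `x` describes the release dates `r` and the distances `d`. -/
structure Describes {n : ℕ} (x : List ℕ) (r : Fin n → ℕ) (d : Fin n → Fin n → ℕ) : Prop where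
  num : x.getD 1 0 = n
  release : ∀ j : Fin n, x.getD (4 + 5 * j) 0 = r j
  dist : ∀ (m : ℕ → ℕ) (e f : Expr) (j k : Fin n), e.eval x m = j → f.eval x m = k →
    (Expr.dist e f).eval x m = d j k

theorem Describes.prio {n : ℕ} {x : List ℕ} {r : Fin n → ℕ} {d : Fin n → Fin n → ℕ}
    (h : Describes x r d) {m : ℕ → ℕ} {e : Expr} {j : Fin n} (he : e.eval x m = j) :
    (Expr.prio e).eval x m = priority r j := by
  simp only [Expr.prio, Expr.release, Expr.num, Expr.eval_add, Expr.eval_mul, Expr.eval_input,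
    Expr.eval_const, he, h.num, h.release, priority]

namespace Prog

open BidirScheduling.Expr

/-- Store the sum of the values of `e`, for `v` from `0` to `n - 1`, in `w`. -/
def sumLoop (v w : Var) (e : Expr) : Prog :=
  seq (set w (const 0)) (loop v (const 0) num (set w (add (var w) e)))

/-- Store the values of `e`, for `v` from `0` to `n - 1`, in row `row` of array `a`. -/
def fill (a v : Var) (row e : Expr) : Prog := loop v (const 0) num (assign a row (var v) e)

/-- Set `bad` to `0` if and only if job `job` may be started next in configuration `cur`. -/
def checkEligible : Prog :=
  seq (set .bad (arr .done (var .cur) (var .job)))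
    (loop .k (const 0) num
      (seq (sumLoop .l .acc (differ (dist (var .job) (var .l)) (dist (var .k) (var .l))))
        (set .bad (add (var .bad) (mul (sub (const 1) (arr .done (var .cur) (var .k)))
          (mul (sub (const 1) (var .acc))
            (sub (const 1) (sub (const 1) (sub (prio (var .job)) (prio (var .k)))))))))))

/-- Extend configuration `cur` by job `job`. -/
def makeCandidate : Prog :=
  seq (fill .newDone .k (const 0)
      (add (arr .done (var .cur) (var .k)) (sub (const 1) (differ (var .k) (var .job)))))
    (seq (fill .newStart .k (const 0)
      (add (arr .start (var .cur) (var .k)) (mul (sub (const 1) (arr .newDone (const 0) (var .k)))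
        (sub (add (arr .start (var .cur) (var .job)) (dist (var .job) (var .k)))
          (arr .start (var .cur) (var .k))))))
      (set .newCost (add (arr .cost (var .cur) (const 0)) (arr .start (var .cur) (var .job)))))

/-- Find a configuration of the next layer that has the same completions as the candidate. -/
def findPosition : Prog :=
  seq (set .pos (var .len))
    (loop .i (var .hi) (var .len)
      (seq (sumLoop .k .acc
          (add (differ (arr .newDone (const 0) (var .k)) (arr .done (var .i) (var .k)))
            (mul (sub (const 1) (arr .newDone (const 0) (var .k)))
              (differ (arr .newStart (const 0) (var .k)) (arr .start (var .i) (var .k))))))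
        (ite (var .acc) skip (set .pos (var .i)))))

/-- Save the candidate at position `pos` if this position is free or its content is worse. -/
def saveCandidate : Prog :=
  ite (add (sub (const 1) (sub (var .len) (var .pos)))
      (sub (arr .cost (var .pos) (const 0)) (var .newCost)))
    (seq (fill .done .k (var .pos) (arr .newDone (const 0) (var .k)))
      (seq (fill .start .k (var .pos) (arr .newStart (const 0) (var .k)))
        (seq (assign .cost (var .pos) (const 0) (var .newCost))
          (set .len (add (var .len) (sub (const 1) (sub (var .len) (var .pos))))))))
    skip

/-- Extend configuration `cur` by job `job` if this is allowed. -/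
def expandJob : Prog :=
  seq checkEligible (ite (var .bad) skip (seq makeCandidate (seq findPosition saveCandidate)))

/-- Compute the next layer of configurations. -/
def expandLayer : Prog :=
  seq (loop .cur (var .lo) (var .hi) (loop .job (const 0) num expandJob))
    (seq (set .lo (var .hi)) (set .hi (var .len)))

/-- The algorithm. -/
def schedule : Prog :=
  seq (fill .start .k (const 0) (release (var .k)))
    (seq (set .hi (const 1))
      (seq (set .len (const 1))
        (seq (loop .layer (const 0) num expandLayer)
          (loop .k (const 0) num (write (arr .start (var .lo) (var .k)))))))

end Prog

/-! ### Correctness and step counts of the subroutines. -/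

open State

namespace Runs

variable {x : List ℕ} {M n : ℕ}

/-- The summand must have value `g k` in every state that differs from `s` only in `v` and `w`, so
the running sum cannot influence later summands. Since all terms are natural numbers, the bound on
the full sum covers the partial sums that get stored. -/
theorem sumLoop (hx : Fits x M) (hn : x.getD 1 0 = n) (hnM : n ≤ M) {v w : Var} {e : Expr}
    {s : State} {Q : State → Prop} (g : ℕ → ℕ) (hv : v ≠ w)
    (hg : ∀ k < n, ∀ s', Frame [v, w] s s' → s'.get v 0 0 = k → e.eval x s'.mem = g k)
    (hsum : ∑ k ∈ Finset.range n, g k ≤ M)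
    (hQ : ∀ s', Frame [v, w] s s' → s'.get w 0 0 = ∑ k ∈ Finset.range n, g k → Q s') :
    Runs x M (Prog.sumLoop v w e) s (4 * n + 3) Q := by
  have hM : 0 < M := by have := hx.1; omega
  refine (seq hM one_pos (set hx (by simp) (loop hx (m := 1) (a := 0) (b := n)
    (fun i s' => Frame [v, w] s s' ∧ s'.get w 0 0 = ∑ k ∈ Finset.range i, g k)
    zero_le hnM rfl ?_ ?_ ?_ ?_))).mono (by omega)
  · refine ⟨((Frame.refl _ _).put (by simp) _ _ _).put (by simp) _ _ _, ?_⟩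
    simp [hv.symm]
  · intro i s' _
    exact hn
  · rintro i s' _ hi ⟨hF, hs⟩ hvi
    have he := hg i hi s' hF hvi
    have hle : ∑ k ∈ Finset.range i, g k + g i ≤ M := by
      rw [← Finset.sum_range_succ]
      exact (Finset.sum_le_sum_of_subset (Finset.range_mono hi)).trans hsum
    refine set hx (by simpa [he, hs] using hle) ⟨by simp [hv, hvi], ?_, ?_⟩
    · exact (hF.put (by simp) _ _ _).put (by simp) _ _ _
    · simp [hv.symm, hs, he, Finset.sum_range_succ]
  · rintro s' ⟨hF, hs⟩
    exact hQ s' hF hs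

theorem fill (hx : Fits x M) (hn : x.getD 1 0 = n) (hnM : n ≤ M) {a v : Var} {row e : Expr}
    {s : State} {Q : State → Prop} (i₀ : ℕ) (g : ℕ → ℕ) (hv : v ≠ a)
    (hrow : ∀ s', Frame [v, a] s s' → row.eval x s'.mem = i₀)
    (hg : ∀ k < n, ∀ s', Frame [v, a] s s' → s'.get v 0 0 = k → e.eval x s'.mem = g k)
    (hle : ∀ k < n, g k ≤ M)
    (hQ : ∀ s', Frame [v, a] s s' →
      (∀ i k, s'.get a i k = if i = i₀ ∧ k < n then g k else s.get a i k) → Q s') :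
    Runs x M (Prog.fill a v row e) s (4 * n + 2) Q := by
  refine (loop hx (m := 1) (a := 0) (b := n)
    (fun t s' => Frame [v, a] s s' ∧
      ∀ i k, s'.get a i k = if i = i₀ ∧ k < t then g k else s.get a i k)
    zero_le hnM rfl ?_ ?_ ?_ ?_).mono (by omega)
  · refine ⟨(Frame.refl _ _).put (by simp) _ _ _, fun i k => ?_⟩
    simp [hv.symm]
  · intro i s' _
    exact hn
  · rintro t s' _ ht ⟨hF, hs⟩ hvt
    have he := hg t ht s' hF hvt
    refine assign hx (by rw [he]; exact hle t ht) ⟨by simp [hv, hvt], ?_, fun i k => ?_⟩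
    · exact (hF.put (by simp) _ _ _).put (by simp) _ _ _
    · simp only [get_put, hv.symm, false_and, if_false, hrow s' hF, Expr.eval_var, hvt, he, hs,
        true_and]
      by_cases h : i = i₀
      · rcases lt_trichotomy k t with h' | h' | h'
        · rw [if_neg (by omega), if_pos ⟨h, h'⟩, if_pos (by omega)]
        · subst h'
          simp [h]
        · rw [if_neg (by omega), if_neg (by omega), if_neg (by omega)]
      · simp [h]
  · rintro s' ⟨hF, hs⟩
    exact hQ s' hF hs

end Runs

/-- The configuration that is stored at position `c`. -/
def State.config (n : ℕ) (s : State) (c : ℕ) : PartialSchedule n :=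
  ⟨fun k => s.get .done c k, fun k => s.get .start c k, s.get .cost c 0⟩

/-- The candidate for the next layer. -/
def State.candidate (n : ℕ) (s : State) : PartialSchedule n :=
  ⟨fun k => s.get .newDone 0 k, fun k => s.get .newStart 0 k, s.get .newCost 0 0⟩

theorem State.Frame.config_eq {n : ℕ} {A : List Var} {s s' : State} (h : Frame A s s')
    (h₁ : .done ∉ A) (h₂ : .start ∉ A) (h₃ : .cost ∉ A) : s'.config n = s.config n := by
  funext c
  simp only [config, h.2 _ h₁, h.2 _ h₂, h.2 _ h₃]

theorem State.Frame.candidate_eq {n : ℕ} {A : List Var} {s s' : State} (h : Frame A s s')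
    (h₁ : .newDone ∉ A) (h₂ : .newStart ∉ A) (h₃ : .newCost ∉ A) :
    s'.candidate n = s.candidate n := by
  simp only [candidate, h.2 _ h₁, h.2 _ h₂, h.2 _ h₃]

namespace Runs

open PartialSchedule

variable {x : List ℕ} {M n : ℕ} {r : Fin n → ℕ} {d : Fin n → Fin n → ℕ}

/-- `bad` counts the reasons against `job`: being done, and every open job with the same row and
smaller priority. Rows are compared by counting their disagreements in `acc`. Each reason
contributes at most `1`, so `bad` stays below `n + 2`. -/
theorem checkEligible (hx : Fits x M) (hD : Describes x r d) (hnM : 2 * n + 2 ≤ M) {s : State}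
    {c : ℕ} {j : Fin n} (hc : s.get .cur 0 0 = c) (hj : s.get .job 0 0 = j)
    (hdone : s.get .done c j ≤ 1) {Q : State → Prop}
    (hQ : ∀ s', Frame [.k, .l, .acc, .bad] s s' →
      (s'.get .bad 0 0 = 0 ↔ Eligible r d (s.config n c) j) → Q s') :
    Runs x M Prog.checkEligible s (n * (4 * n + 7) + 3) Q := by
  have hM : 0 < M := by have := hx.1; omega
  refine (seq hM one_pos (set hx (by simp [hc, hj]; omega)
    (loop hx (m := 4 * n + 4) (a := 0) (b := n)
    (fun i s' => Frame [.k, .l, .acc, .bad] s s' ∧ s'.get .bad 0 0 ≤ 1 + i ∧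
      (s'.get .bad 0 0 = 0 ↔ s.get .done c j = 0 ∧ ∀ k : Fin n, k < i → s.get .done c k = 0 →
        d j = d k → priority r j ≤ priority r k))
    zero_le (by omega) rfl ?_ ?_ ?_ ?_))).mono (by rw [Nat.sub_zero]; linarith)
  · refine ⟨((Frame.refl _ _).put (by simp) _ _ _).put (by simp) _ _ _, ?_⟩
    simp [hc, hj, hdone]
  · intro i s' _
    exact hD.num
  · rintro i s' _ hi ⟨hF, hle, hbad⟩ hki
    have hrow : ∀ k < n, ∀ s'', Frame [.l, .acc] s' s'' → s''.get .l 0 0 = k →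
        (Expr.differ (.dist (.var .job) (.var .l)) (.dist (.var .k) (.var .l))).eval x s''.mem =
          if h : k < n then if d j ⟨k, h⟩ = d ⟨i, hi⟩ ⟨k, h⟩ then 0 else 1 else 0 := by
      intro k hk s'' hF' hl
      have h₁ : s''.get .job 0 0 = j := by
        rw [hF'.2 _ (by simp), hF.2 _ (by simp), hj]
      have h₂ : s''.get .k 0 0 = i := by rw [hF'.2 _ (by simp), hki]
      rw [Expr.eval_differ, hD.dist _ (.var .job) (.var .l) j ⟨k, hk⟩ h₁ hl,
        hD.dist _ (.var .k) (.var .l) ⟨i, hi⟩ ⟨k, hk⟩ h₂ hl, dif_pos hk]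
    have hsum : ∑ k ∈ Finset.range n, (if h : k < n then
        if d j ⟨k, h⟩ = d ⟨i, hi⟩ ⟨k, h⟩ then 0 else 1 else 0) ≤ M := by
      refine (Finset.sum_le_card_nsmul _ _ 1 fun k _ => ?_).trans (by simp; omega)
      split_ifs <;> simp
    refine seq hM (n := 4 * n + 3) (n' := 1) (by omega) (sumLoop hx hD.num (by omega) _ (by simp) hrow hsum ?_)
    intro s'' hF' hacc
    have hjob : (Expr.var .job).eval x s''.mem = j := by
      rw [Expr.eval_var, hF'.2 _ (by simp), hF.2 _ (by simp), hj]
    have hk' : (Expr.var .k).eval x s''.mem = i := by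
      rw [Expr.eval_var, hF'.2 _ (by simp), hki]
    have hcur : s''.get .cur 0 0 = c := by
      rw [hF'.2 _ (by simp), hF.2 _ (by simp), hc]
    have hbad' : s''.get .bad 0 0 = s'.get .bad 0 0 := hF'.2 _ (by simp) _ _
    have hdn : s''.get .done c i = s.get .done c i := by
      rw [hF'.2 _ (by simp), hF.2 _ (by simp)]
    have hp₁ := hD.prio (j := j) hjob
    have hp₂ := hD.prio (j := ⟨i, hi⟩) hk'
    have hacc₀ : s''.get .acc 0 0 = 0 ↔ d j = d ⟨i, hi⟩ := by
      rw [hacc, Finset.sum_eq_zero_iff, funext_iff]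
      constructor
      · intro h k
        have := h k (by simp)
        simpa using this
      · intro h k hk
        rw [dif_pos (by simpa using hk), if_pos (h _)]
    rw [Expr.eval_var] at hk'
    have hval : (1 - s''.get .done c i) * ((1 - s''.get .acc 0 0) *
        (1 - (1 - (priority r j - priority r ⟨i, hi⟩)))) ≤ 1 * (1 * 1) :=
      Nat.mul_le_mul (Nat.sub_le _ _) (Nat.mul_le_mul (Nat.sub_le _ _) (Nat.sub_le _ _))
    refine set hx ?_ ?_
    · simp only [Expr.eval_add, Expr.eval_mul, Expr.eval_sub, Expr.eval_const, Expr.eval_arr,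
        Expr.eval_var, hp₁, hp₂, hcur, hk', hbad']
      omega
    · simp only [Expr.eval_add, Expr.eval_mul, Expr.eval_sub, Expr.eval_const, Expr.eval_arr,
        Expr.eval_var, hp₁, hp₂, hcur, hk', hbad']
      refine ⟨by simp [hk'], ?_, ?_⟩
      · exact ((hF.trans (hF'.mono (by simp))).put (by simp) _ _ _).put (by simp) _ _ _
      · simp only [get_put, reduceCtorEq, false_and, if_false, and_self, if_true]
        refine ⟨by omega, ?_⟩
        rw [Nat.add_eq_zero_iff, hbad, and_assoc]
        refine and_congr_right fun _ => ?_
        -- The product of truncated differences is the negated implication: it is nonzero only for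
        -- an open job with equal row and strictly smaller priority.
        have hz : (1 - s''.get .done c i) * ((1 - s''.get .acc 0 0) *
            (1 - (1 - (priority r j - priority r ⟨i, hi⟩)))) = 0 ↔
            (s.get .done c i = 0 → d j = d ⟨i, hi⟩ → priority r j ≤ priority r ⟨i, hi⟩) := by
          rw [← hacc₀, hdn, Nat.mul_eq_zero, Nat.mul_eq_zero]
          omega
        rw [hz]
        constructor
        · rintro ⟨h₁, h₂⟩ k hk
          rcases Nat.lt_succ_iff_lt_or_eq.1 hk with h | h
          · exact h₁ k h
          · have : k = ⟨i, hi⟩ := Fin.ext h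
            subst this
            exact h₂
        · intro h
          exact ⟨fun k hk => h k (by omega), h ⟨i, hi⟩ (Nat.lt_succ_self i)⟩
  · rintro s' ⟨hF, -, hbad⟩
    refine hQ s' hF ?_
    rw [hbad]
    simp only [Eligible, State.config]
    exact and_congr_right fun _ => ⟨fun h k => h k k.isLt, fun h k _ => h k⟩

/-- The maximum in `extend` is computed as `u + (v - u)` with truncated subtraction. The factor `1 -
newDone` switches the update off for done jobs and for `job` itself, so the new flags have to be
filled in first. -/
theorem makeCandidate (hx : Fits x M) (hD : Describes x r d) (hnM : n ≤ M) {s : State}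
    {c : ℕ} {j : Fin n} (hc : s.get .cur 0 0 = c) (hj : s.get .job 0 0 = j)
    (hle₁ : ∀ k, ((s.config n c).extend d j).done k ≤ M)
    (hle₂ : ∀ k, ((s.config n c).extend d j).start k ≤ M)
    (hle₃ : ((s.config n c).extend d j).cost ≤ M) {Q : State → Prop}
    (hQ : ∀ s', Frame [.k, .newDone, .newStart, .newCost] s s' →
      s'.candidate n = (s.config n c).extend d j → Q s') :
    Runs x M Prog.makeCandidate s (8 * n + 5) Q := by
  have hM : 0 < M := by have := hx.1; omega
  let e := (s.config n c).extend d j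
  refine (seq hM (Nat.succ_pos _) (fill hx hD.num hnM 0
    (fun k => if h : k < n then e.done ⟨k, h⟩ else 0) (by simp) (fun _ _ => rfl) ?_ ?_ ?_)).mono
    (n := 4 * n + 2 + (4 * n + 2 + 1)) (by omega)
  · intro k hk s' hF hks
    have h₁ : s'.get .cur 0 0 = c := by rw [hF.2 _ (by simp), hc]
    have h₂ : s'.get .job 0 0 = j := by rw [hF.2 _ (by simp), hj]
    have h₃ : s'.get .done c k = s.get .done c k := hF.2 _ (by simp) _ _
    simp only [Expr.eval_add, Expr.eval_arr, Expr.eval_var, Expr.eval_sub, Expr.eval_const,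
      Expr.eval_differ, h₁, h₂, h₃, hks, dif_pos hk, e, extend, State.config, Fin.ext_iff]
    congr 1
    split_ifs <;> rfl
  · intro k hk
    simpa [hk] using hle₁ ⟨k, hk⟩
  intro s₁ hF₁ hs₁
  refine seq hM (Nat.succ_pos _) (fill hx hD.num hnM 0
    (fun k => if h : k < n then e.start ⟨k, h⟩ else 0) (by simp) (fun _ _ => rfl) ?_ ?_ ?_)
  · intro k hk s' hF hks
    have h₁ : s'.get .cur 0 0 = c := by rw [hF.2 _ (by simp), hF₁.2 _ (by simp), hc]
    have h₂ : s'.get .job 0 0 = j := by rw [hF.2 _ (by simp), hF₁.2 _ (by simp), hj]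
    have h₃ : ∀ k, s'.get .start c k = s.get .start c k := fun k => by
      rw [hF.2 _ (by simp), hF₁.2 _ (by simp)]
    have h₄ : s'.get .newDone 0 k = e.done ⟨k, hk⟩ := by
      rw [hF.2 _ (by simp), hs₁, if_pos ⟨rfl, hk⟩, dif_pos hk]
    have h₅ := hD.dist s'.mem (.var .job) (.var .k) j ⟨k, hk⟩ h₂ hks
    simp only [Expr.eval_add, Expr.eval_arr, Expr.eval_var, Expr.eval_sub, Expr.eval_const,
      Expr.eval_mul, h₁, h₂, h₃, h₄, h₅, hks, dif_pos hk]
    change _ + (1 - (s.get .done c k + if (⟨k, hk⟩ : Fin n) = j then 1 else 0)) * _ =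
      if s.get .done c k = 0 ∧ (⟨k, hk⟩ : Fin n) ≠ j then
        max (s.get .start c k) (s.get .start c j + d j ⟨k, hk⟩) else s.get .start c k
    by_cases hd₀ : s.get .done c k = 0 ∧ (⟨k, hk⟩ : Fin n) ≠ j
    · rw [if_pos hd₀, if_neg hd₀.2, hd₀.1, add_zero, Nat.sub_zero, one_mul]
      omega
    · rw [if_neg hd₀]
      have : 1 - (s.get .done c k + if (⟨k, hk⟩ : Fin n) = j then 1 else 0) = 0 := by
        split_ifs with h
        · omega
        · have : s.get .done c k ≠ 0 := fun h' => hd₀ ⟨h', h⟩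
          omega
      rw [this, zero_mul, add_zero]
  · intro k hk
    simpa [hk] using hle₂ ⟨k, hk⟩
  intro s₂ hF₂ hs₂
  have hF : Frame [.k, .newDone, .newStart, .newCost] s s₂ :=
    (hF₁.mono (by simp)).trans (hF₂.mono (by simp))
  have hcost : s₂.get .cost (s₂.get .cur 0 0) 0 +
      s₂.get .start (s₂.get .cur 0 0) (s₂.get .job 0 0) = e.cost := by
    simp only [hF.2 .cur (by simp), hF.2 .job (by simp), hF.2 .cost (by simp),
      hF.2 .start (by simp), hc, hj]
    rfl
  refine set hx ?_ (hQ _ (hF.put (by simp) _ _ _) ?_)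
  · simp only [Expr.eval_add, Expr.eval_arr, Expr.eval_var, Expr.eval_const, hcost]
    exact hle₃
  · simp only [Expr.eval_add, Expr.eval_arr, Expr.eval_var, Expr.eval_const, hcost, candidate,
      get_put, reduceCtorEq, false_and, if_false, and_self, if_true]
    ext k
    · simp only
      rw [hF₂.2 _ (by simp), hs₁]
      simp [e]
    · simp only
      rw [hs₂]
      simp [e]
    · rfl

/-- The default value `len` of `pos` means that no entry matches; every match overwrites it. `acc`
collects at most two mismatches per job, whence the requirement `2 * n ≤ M`. -/
theorem findPosition (hx : Fits x M) (hn : x.getD 1 0 = n) (hnM : 2 * n ≤ M) {s : State}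
    {a b : ℕ} (ha : s.get .hi 0 0 = a) (hb : s.get .len 0 0 = b) (hab : a ≤ b) (hbM : b ≤ M)
    {Q : State → Prop}
    (hQ : ∀ s' q, Frame [.k, .i, .acc, .pos] s s' → s'.get .pos 0 0 = q → a ≤ q → q ≤ b →
      (q < b → SameKey (s.candidate n) (s.config n q)) →
      (q = b → ∀ i, a ≤ i → i < b → ¬ SameKey (s.candidate n) (s.config n i)) → Q s') :
    Runs x M Prog.findPosition s ((b - a) * (4 * n + 8) + 3) Q := by
  have hM : 0 < M := by have := hx.1; omega
  refine (seq hM one_pos (set hx (by simp [hb]; omega)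
    (loop hx (m := 4 * n + 5) (a := a) (b := b)
    (fun t s' => Frame [.k, .i, .acc, .pos] s s' ∧ a ≤ s'.get .pos 0 0 ∧ s'.get .pos 0 0 ≤ b ∧
      (s'.get .pos 0 0 < b → SameKey (s.candidate n) (s.config n (s'.get .pos 0 0))) ∧
      (s'.get .pos 0 0 = b → ∀ i, a ≤ i → i < t → ¬ SameKey (s.candidate n) (s.config n i)))
    hab hbM (by simp [ha]) ?_ ?_ ?_ ?_))).mono (by ring_nf; omega)
  · refine ⟨((Frame.refl _ _).put (by simp) _ _ _).put (by simp) _ _ _, ?_⟩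
    simp only [Expr.eval_var, hb, get_put, reduceCtorEq, false_and, if_false, and_self,
      if_true]
    exact ⟨hab, le_rfl, fun h => absurd h (lt_irrefl _), fun _ i h h' => by omega⟩
  · rintro i s' ⟨hF, -⟩
    rw [Expr.eval_var, hF.2 _ (by simp), hb]
  · rintro i s' hai hib ⟨hF, h₁, h₂, h₃, h₄⟩ hi
    have hterm : ∀ k < n, ∀ s'', Frame [.k, .acc] s' s'' → s''.get .k 0 0 = k →
        (Expr.add (.differ (.arr .newDone (.const 0) (.var .k)) (.arr .done (.var .i) (.var .k)))
            (.mul (.sub (.const 1) (.arr .newDone (.const 0) (.var .k)))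
              (.differ (.arr .newStart (.const 0) (.var .k))
                (.arr .start (.var .i) (.var .k))))).eval x s''.mem =
        (if s.get .newDone 0 k = s.get .done i k then 0 else 1) + (1 - s.get .newDone 0 k) *
          (if s.get .newStart 0 k = s.get .start i k then 0 else 1) := by
      intro k hk s'' hF' hks
      simp only [Expr.eval_add, Expr.eval_arr, Expr.eval_var, Expr.eval_sub, Expr.eval_const,
        Expr.eval_mul, Expr.eval_differ, hks, hF'.2 .i (by simp), hi, hF'.2 .newDone (by simp),
        hF'.2 .done (by simp), hF'.2 .newStart (by simp), hF'.2 .start (by simp),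
        hF.2 .newDone (by simp), hF.2 .done (by simp), hF.2 .newStart (by simp),
        hF.2 .start (by simp)]
    have hsum : ∑ k ∈ Finset.range n,
        ((if s.get .newDone 0 k = s.get .done i k then 0 else 1) + (1 - s.get .newDone 0 k) *
          (if s.get .newStart 0 k = s.get .start i k then 0 else 1)) ≤ M := by
      refine (Finset.sum_le_card_nsmul _ _ 2 fun k _ => ?_).trans (by simp; omega)
      have h01 : ∀ (p : Prop) [Decidable p], (if p then 0 else 1) ≤ 1 := fun p _ => by
        split_ifs <;> simp
      exact Nat.add_le_add (h01 _) (Nat.mul_le_mul (Nat.sub_le _ _) (h01 _))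
    refine seq hM (n := 4 * n + 3) (n' := 2) (by omega) (sumLoop hx hn (by omega) _ (by simp) hterm hsum ?_)
    intro s'' hF' hacc
    have hF'' := hF.trans (hF'.mono (B := [.k, .i, .acc, .pos]) (by simp))
    have hpos : s''.get .pos 0 0 = s'.get .pos 0 0 := hF'.2 _ (by simp) _ _
    have hi' : s''.get .i 0 0 = i := by rw [hF'.2 _ (by simp), hi]
    have hkey : s''.get .acc 0 0 = 0 ↔ SameKey (s.candidate n) (s.config n i) := by
      rw [hacc, Finset.sum_eq_zero_iff]
      have hk : ∀ k, ((if s.get .newDone 0 k = s.get .done i k then 0 else 1) +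
          (1 - s.get .newDone 0 k) *
          (if s.get .newStart 0 k = s.get .start i k then 0 else 1) = 0) ↔
          (s.get .newDone 0 k = s.get .done i k ∧
            (s.get .newDone 0 k = 0 → s.get .newStart 0 k = s.get .start i k)) := by
        intro k
        rw [Nat.add_eq_zero_iff, Nat.mul_eq_zero]
        refine and_congr (by simp) ?_
        split_ifs with h <;> simp [h]
        omega
      simp only [hk, Finset.mem_range]
      exact ⟨fun h k => h k k.isLt, fun h k hk => h ⟨k, hk⟩⟩
    refine ite hx (fun h => ?_) (fun h => ?_)
    · rw [Expr.eval_var, ne_eq, hkey] at h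
      refine skip hx ⟨hi', hF''.put (by simp) _ _ _, ?_⟩
      simp only [get_put, reduceCtorEq, false_and, if_false, hpos]
      refine ⟨h₁, h₂, h₃, fun hp t hat hti => ?_⟩
      rcases Nat.lt_succ_iff_lt_or_eq.1 hti with h' | rfl
      · exact h₄ hp t hat h'
      · exact h
    · rw [Expr.eval_var, hkey] at h
      refine set hx (by simp [hi']; omega) ⟨by simp [hi'],
        (hF''.put (by simp) _ _ _).put (by simp) _ _ _, ?_⟩
      simp only [get_put, reduceCtorEq, false_and, if_false, and_self,
        if_true, Expr.eval_var, hi']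
      exact ⟨hai, hib.le, fun _ => h, fun h' => by omega⟩
  · rintro s' ⟨hF, h₁, h₂, h₃, h₄⟩
    exact hQ s' _ hF rfl h₁ h₂ h₃ h₄

/-- The test is nonzero exactly if the position is the free slot `len` or holds a strictly larger
cost. The increment of `len` is `1` only in the first case. -/
theorem saveCandidate (hx : Fits x M) (hn : x.getD 1 0 = n) (hnM : n ≤ M) {s : State}
    {q b : ℕ} (hq : s.get .pos 0 0 = q) (hb : s.get .len 0 0 = b) (hqb : q ≤ b) (hbM : b + 1 ≤ M)
    (hle₁ : ∀ k, (s.candidate n).done k ≤ M) (hle₂ : ∀ k, (s.candidate n).start k ≤ M)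
    (hle₃ : (s.candidate n).cost ≤ M) {Q : State → Prop}
    (hQ₁ : ∀ s', Frame [.k, .done, .start, .cost, .len] s s' →
      (∀ i, i ≠ q → s'.config n i = s.config n i) → s'.config n q = s.candidate n →
      (q < b → s'.get .len 0 0 = b ∧ (s.candidate n).cost < (s.config n q).cost) →
      (q = b → s'.get .len 0 0 = b + 1) → Q s')
    (hQ₂ : q < b → (s.config n q).cost ≤ (s.candidate n).cost → Q s) :
    Runs x M Prog.saveCandidate s (8 * n + 7) Q := by
  have hM : 0 < M := by have := hx.1; omega
  refine (ite hx (n := 4 * n + 2 + (4 * n + 2 + (1 + 1))) (fun h => ?_) (fun h => ?_)).mono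
    (by omega)
  · simp only [Expr.eval_add, Expr.eval_arr, Expr.eval_var, Expr.eval_sub, Expr.eval_const, hq,
      hb] at h
    refine seq hM (Nat.succ_pos _) (fill hx hn hnM q (fun k => s.get .newDone 0 k) (by simp)
      (fun s' hF => by rw [Expr.eval_var, hF.2 _ (by simp), hq]) ?_
      (fun k hk => hle₁ ⟨k, hk⟩) ?_)
    · intro k hk s' hF hks
      rw [Expr.eval_arr, Expr.eval_var, hks, hF.2 _ (by simp), Expr.eval_const]
    intro s₁ hF₁ hs₁
    refine seq hM (Nat.succ_pos _) (fill hx hn hnM q (fun k => s.get .newStart 0 k) (by simp)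
      (fun s' hF => by rw [Expr.eval_var, hF.2 _ (by simp), hF₁.2 _ (by simp), hq]) ?_
      (fun k hk => hle₂ ⟨k, hk⟩) ?_)
    · intro k hk s' hF hks
      rw [Expr.eval_arr, Expr.eval_var, hks, hF.2 _ (by simp), hF₁.2 _ (by simp), Expr.eval_const]
    intro s₂ hF₂ hs₂
    have hF : Frame [.k, .done, .start, .cost, .len] s s₂ :=
      (hF₁.mono (by simp)).trans (hF₂.mono (by simp))
    have hq₂ : s₂.get .pos 0 0 = q := by rw [hF.2 _ (by simp), hq]
    have hc₂ : s₂.get .newCost 0 0 = s.get .newCost 0 0 := hF.2 _ (by simp) _ _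
    have hb₂ : s₂.get .len 0 0 = b := by rw [hF₂.2 _ (by simp), hF₁.2 _ (by simp), hb]
    have hcost₂ : ∀ i, s₂.get .cost i 0 = s.get .cost i 0 := fun i => by
      rw [hF₂.2 _ (by simp), hF₁.2 _ (by simp)]
    have hdone₂ : ∀ i k, s₂.get .done i k = if i = q ∧ k < n then s.get .newDone 0 k else
        s.get .done i k := fun i k => by rw [hF₂.2 _ (by simp), hs₁]
    have hstart₂ : ∀ i k, s₂.get .start i k = if i = q ∧ k < n then s.get .newStart 0 k else
        s.get .start i k := fun i k => by rw [hs₂, hF₁.2 _ (by simp)]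
    refine seq hM one_pos (assign hx (by rw [Expr.eval_var, hc₂]; exact hle₃) ?_)
    simp only [Expr.eval_var, Expr.eval_const, hq₂, hc₂]
    refine set hx ?_ ?_
    · simp [hb₂, hq₂]
      omega
    · simp only [Expr.eval_add, Expr.eval_var, Expr.eval_sub, Expr.eval_const, get_put,
        reduceCtorEq, false_and, if_false, hb₂, hq₂]
      refine hQ₁ _ ((hF.put (by simp) _ _ _).put (by simp) _ _ _) (fun i hi => ?_) ?_
        (fun h' => ⟨?_, ?_⟩) (fun h' => ?_)
      · simp [State.config, hi, hdone₂, hstart₂, hcost₂]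
      · simp [State.config, State.candidate, hdone₂, hstart₂]
      · simp
        omega
      · simp only [State.candidate, State.config]
        omega
      · simp
        omega
  · simp only [Expr.eval_add, Expr.eval_arr, Expr.eval_var, Expr.eval_sub, Expr.eval_const, hq,
      hb] at h
    refine (skip hx (hQ₂ (by omega) ?_)).mono (by omega)
    simp only [State.candidate, State.config]
    omega

end Runs
end BidirScheduling

/-! ### Correctness of the dynamic program over layers of configurations. -/

namespace BidirScheduling

open State PartialSchedule

/-- The entries of `T` between `a` and `b` are configurations of layer `l` that have pairwise
different completions. -/
structure Table {n : ℕ} (r : Fin n → ℕ) (d : Fin n → Fin n → ℕ) (p q l a b : ℕ)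
    (T : ℕ → PartialSchedule n) : Prop where
  le : a ≤ b
  valid : ∀ i, a ≤ i → i < b → Valid r d p q l (T i)
  distinct : ∀ i i', a ≤ i → i < b → a ≤ i' → i' < b → SameKey (T i) (T i') → i = i'

/-- One of the entries of `T` between `a` and `b` is as good as `c`. -/
def Covered {n : ℕ} (T : ℕ → PartialSchedule n) (a b : ℕ) (c : PartialSchedule n) : Prop :=
  ∃ i, a ≤ i ∧ i < b ∧ SameKey (T i) c ∧ (T i).cost ≤ c.cost

theorem Table.card_le {n : ℕ} {r : Fin n → ℕ} {d : Fin n → Fin n → ℕ} {p q l a b : ℕ}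
    {T : ℕ → PartialSchedule n} (h : Table r d p q l a b T) (hl : l ≤ n) :
    b - a ≤ ((n + 1) * (n * (n + 1) ^ 2 + 1)) ^ (Finset.univ.image d).card := by
  have := card_le_of_valid (r := r) (d := d) (p := p) (q := q) (Finset.Ico a b) T hl
    (fun i hi => h.valid i (Finset.mem_Ico.1 hi).1 (Finset.mem_Ico.1 hi).2)
    (fun i hi i' hi' => h.distinct i i' (Finset.mem_Ico.1 hi).1 (Finset.mem_Ico.1 hi).2
      (Finset.mem_Ico.1 hi').1 (Finset.mem_Ico.1 hi').2)
  rwa [Nat.card_Ico] at this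

/-- `s'` arises from `s` by changing some of the arrays in `A`, without changing the configurations
before position `b` and without losing good configurations after it. -/
structure Grows (n : ℕ) (A : List Var) (b : ℕ) (s s' : State) : Prop where
  frame : Frame A s s'
  old : ∀ i < b, s'.config n i = s.config n i
  covered : ∀ c, Covered (s.config n) b (s.get .len 0 0) c →
    Covered (s'.config n) b (s'.get .len 0 0) c

theorem Grows.refl (n : ℕ) (A : List Var) (b : ℕ) (s : State) : Grows n A b s s :=
  ⟨.refl _ _, fun _ _ => rfl, fun _ h => h⟩

theorem Grows.trans {n : ℕ} {A : List Var} {b : ℕ} {s s' s'' : State} (h : Grows n A b s s')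
    (h' : Grows n A b s' s'') : Grows n A b s s'' :=
  ⟨h.frame.trans h'.frame, fun i hi => (h'.old i hi).trans (h.old i hi),
    fun c hc => h'.covered c (h.covered c hc)⟩

theorem Grows.mono {n : ℕ} {A B : List Var} {b : ℕ} {s s' : State} (h : Grows n A b s s')
    (hAB : A ⊆ B) : Grows n B b s s' :=
  ⟨h.frame.mono hAB, h.old, h.covered⟩

theorem State.Frame.grows {n : ℕ} {A : List Var} {s s' : State} (h : Frame A s s')
    (h₁ : .done ∉ A) (h₂ : .start ∉ A) (h₃ : .cost ∉ A) (h₄ : .len ∉ A) (b : ℕ) :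
    Grows n A b s s' :=
  ⟨h, fun i _ => by rw [h.config_eq h₁ h₂ h₃], fun c hc => by
    rwa [h.config_eq h₁ h₂ h₃, h.2 _ h₄]⟩

theorem State.grows_put (n : ℕ) (s : State) {a : Var} (i j v : ℕ) (h₁ : a ≠ .done)
    (h₂ : a ≠ .start) (h₃ : a ≠ .cost) (h₄ : a ≠ .len) (b : ℕ) :
    Grows n [a] b s (s.put a i j v) :=
  ((Frame.refl _ _).put (by simp) _ _ _).grows (by simpa using h₁.symm) (by simpa using h₂.symm)
    (by simpa using h₃.symm) (by simpa using h₄.symm) b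

theorem State.config_put (n : ℕ) (s : State) {a : Var} (i j v : ℕ) (h₁ : a ≠ .done)
    (h₂ : a ≠ .start) (h₃ : a ≠ .cost) : (s.put a i j v).config n = s.config n :=
  ((Frame.refl [a] s).put (by simp) i j v).config_eq (by simpa using h₁.symm)
    (by simpa using h₂.symm) (by simpa using h₃.symm)

/-- The arrays that are changed when a configuration is extended by a job. -/
def scratch : List Var :=
  [.k, .l, .i, .acc, .bad, .pos, .newDone, .newStart, .newCost, .done, .start, .cost, .len]

/-- The input `x` describes `r` and `d`, all distances are `0`, `p` or `q`, no layer has more than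
`N` configurations, and `M` is a bound for all numbers that the program has to store. -/
structure Setting {n : ℕ} (x : List ℕ) (M N : ℕ) (r : Fin n → ℕ) (d : Fin n → Fin n → ℕ)
    (p q : ℕ) : Prop where
  fits : Fits x M
  describes : Describes x r d
  symm : ∀ j k, d j k = d k j
  values : ∀ j k, d j k = 0 ∨ d j k = p ∨ d j k = q
  num_le : 2 * n + 2 ≤ M
  start_le : ∀ l ≤ n, ∀ c, Valid r d p q l c → ∀ k, c.start k ≤ M
  cost_le : ∀ l ≤ n, ∀ c, Valid r d p q l c → c.cost ≤ M
  card_le : ((n + 1) * (n * (n + 1) ^ 2 + 1)) ^ (Finset.univ.image d).card ≤ N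
  table_le : (n + 1) * N + 2 ≤ M

/-- A bound on the number of steps for the extension of a configuration by a job. -/
def jobSteps {R : Type*} [CommSemiring R] (n N : R) : R :=
  n * (4 * n + 7) + 3 + (8 * n + 5 + (N * (4 * n + 8) + 3 + (8 * n + 7)) + 1)

/-- A bound on the number of steps for a layer. -/
def layerSteps {R : Type*} [CommSemiring R] (n N : R) : R :=
  N * (n * (jobSteps n N + 3) + 2 + 3) + 2 + 2

/-- A bound on the number of steps of the algorithm. -/
def totalSteps {R : Type*} [CommSemiring R] (n N : R) : R :=
  4 * n + 2 + (1 + (1 + (n * (layerSteps n N + 3) + 2 + (n * (1 + 3) + 2))))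

namespace Runs

variable {x : List ℕ} {M N n : ℕ} {r : Fin n → ℕ} {d : Fin n → Fin n → ℕ} {p q : ℕ}

/-- Overwriting happens only at an entry with the same key and a larger cost, appending only if the
key is new, and rejection only if an entry with the same key is at least as cheap. So keys stay
distinct and nothing that was covered is lost. Distinctness bounds the table by `N`, which keeps the
new position below `M`. -/
theorem insertCandidate (h : Setting x M N r d p q) {s : State} {l a b : ℕ}
    (ha : s.get .hi 0 0 = a) (hb : s.get .len 0 0 = b) (hT : Table r d p q l a b (s.config n))
    (hl : l ≤ n) (haM : a + N + 1 ≤ M) (hv : Valid r d p q l (s.candidate n))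
    {Q : State → Prop}
    (hQ : ∀ s', Grows n scratch a s s' → Table r d p q l a (s'.get .len 0 0) (s'.config n) →
      Covered (s'.config n) a (s'.get .len 0 0) (s.candidate n) → Q s') :
    Runs x M (.seq .findPosition .saveCandidate) s (N * (4 * n + 8) + 3 + (8 * n + 7)) Q := by
  have hM : 0 < M := by omega
  have hnM := h.num_le
  have hbN : b - a ≤ N := (hT.card_le hl).trans h.card_le
  have hab := hT.le
  refine seq hM (by omega) ((findPosition (M := M) h.fits h.describes.num (by omega) ha hb hT.le
    (by omega) ?_).mono (Nat.add_le_add_right (Nat.mul_le_mul_right _ hbN) 3))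
  intro s₁ t hF₁ hpos hat htb hkey hnew
  have hcand := hF₁.candidate_eq (n := n) (by simp) (by simp) (by simp)
  have hconf := hF₁.config_eq (n := n) (by simp) (by simp) (by simp)
  have hlen : s₁.get .len 0 0 = b := by rw [hF₁.2 _ (by simp), hb]
  refine saveCandidate h.fits h.describes.num (by omega) hpos hlen htb (by omega) ?_ ?_ ?_ ?_ ?_
  · rw [hcand]
    intro k
    have := hv.done_le_one k
    omega
  · rw [hcand]
    exact h.start_le l hl _ hv
  · rw [hcand]
    exact h.cost_le l hl _ hv
  · intro s₂ hF₂ hother hpos₂ hlt heq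
    rw [hcand] at hpos₂ hlt
    rw [hconf] at hother hlt
    have hF : Frame scratch s s₂ :=
      (hF₁.mono (by simp [scratch])).trans (hF₂.mono (by simp [scratch]))
    have hold : ∀ i < a, s₂.config n i = s.config n i := fun i hi => hother i (by omega)
    rcases htb.lt_or_eq with htb' | rfl
    · have hlen₂ := (hlt htb').1
      -- Overwriting changes costs and the starts of done jobs, but no key.
      have hval : ∀ i, SameKey (s₂.config n i) (s.config n i) := by
        intro i
        by_cases hi : i = t
        · subst hi
          rw [hpos₂]
          exact hkey htb'
        · rw [hother i hi]
          exact .refl _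
      refine hQ s₂ ⟨hF, hold, ?_⟩ ⟨?_, ?_, ?_⟩ ⟨t, hat, ?_, ?_, ?_⟩
      · rintro c ⟨i, h₁, h₂, h₃, h₄⟩
        refine ⟨i, h₁, by omega, (hval i).trans h₃, ?_⟩
        by_cases hi : i = t
        · subst hi
          rw [hpos₂]
          exact (hlt htb').2.le.trans h₄
        · rwa [hother i hi]
      · omega
      · intro i h₁ h₂
        by_cases hi : i = t
        · subst hi
          rwa [hpos₂]
        · rw [hother i hi]
          exact hT.valid i h₁ (by omega)
      · intro i i' h₁ h₂ h₃ h₄ h₅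
        exact hT.distinct i i' h₁ (by omega) h₃ (by omega) (((hval i).symm.trans h₅).trans (hval i'))
      · omega
      · rw [hpos₂]
        exact .refl _
      · rw [hpos₂]
    · have hlen₂ := heq rfl
      have hnew' := hnew rfl
      refine hQ s₂ ⟨hF, hold, ?_⟩ ⟨?_, ?_, ?_⟩ ⟨t, hat, ?_, ?_, ?_⟩
      · rintro c ⟨i, h₁, h₂, h₃⟩
        exact ⟨i, h₁, by omega, by rwa [hother i (by omega)]⟩
      · omega
      · intro i h₁ h₂
        by_cases hi : i = t
        · subst hi
          rwa [hpos₂]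
        · rw [hother i hi]
          exact hT.valid i h₁ (by omega)
      · intro i i' h₁ h₂ h₃ h₄ h₅
        by_cases hi : i = t
        · subst hi
          by_contra hi'
          rw [hpos₂, hother i' (Ne.symm hi')] at h₅
          exact hnew' i' h₃ (by omega) h₅
        · rw [hother i hi] at h₅
          by_cases hi' : i' = t
          · subst hi'
            rw [hpos₂] at h₅
            exact absurd h₅.symm (hnew' i h₁ (by omega))
          · rw [hother i' hi'] at h₅
            exact hT.distinct i i' h₁ (by omega) h₃ (by omega) h₅
      · omega
      · rw [hpos₂]
        exact .refl _
      · rw [hpos₂]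
  · intro htb' hcost
    rw [hcand, hconf] at hcost
    refine hQ s₁ ((hF₁.grows (by simp) (by simp) (by simp) (by simp) a).mono
      (by simp [scratch])) ?_ ?_
    · rw [hlen, hconf]
      exact hT
    · rw [hlen, hconf]
      exact ⟨t, hat, htb', (hkey htb').symm, hcost⟩

theorem expandJob (h : Setting x M N r d p q) {s : State} {l a c : ℕ} {j : Fin n}
    (hc : s.get .cur 0 0 = c) (hj : s.get .job 0 0 = j) (ha : s.get .hi 0 0 = a)
    (hT : Table r d p q (l + 1) a (s.get .len 0 0) (s.config n))
    (hl : l < n) (haM : a + N + 1 ≤ M) (hv : Valid r d p q l (s.config n c)) {Q : State → Prop}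
    (hQ : ∀ s', Grows n scratch a s s' →
      Table r d p q (l + 1) a (s'.get .len 0 0) (s'.config n) →
      (Eligible r d (s.config n c) j →
        Covered (s'.config n) a (s'.get .len 0 0) ((s.config n c).extend d j)) → Q s') :
    Runs x M .expandJob s (jobSteps n N) Q := by
  have hM : 0 < M := by omega
  have hnM := h.num_le
  refine seq hM (by omega) (checkEligible h.fits h.describes h.num_le hc hj (hv.done_le_one j) ?_)
  intro s₁ hF₁ hbad
  have hconf := hF₁.config_eq (n := n) (by simp) (by simp) (by simp)
  have hlen : s₁.get .len 0 0 = s.get .len 0 0 := hF₁.2 _ (by simp) _ _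
  have hG₁ : Grows n scratch a s s₁ :=
    (hF₁.grows (by simp) (by simp) (by simp) (by simp) a).mono (by simp [scratch])
  refine ite h.fits (fun hb => ?_) (fun hb => ?_)
  · rw [Expr.eval_var, ne_eq, hbad] at hb
    refine (skip h.fits (hQ s₁ hG₁ ?_ (fun he => absurd he hb))).mono (by omega)
    rwa [hlen, hconf]
  · rw [Expr.eval_var, hbad] at hb
    have hv' := hv.extend h.symm h.values hb
    refine seq hM (by omega) (makeCandidate h.fits h.describes (by omega)
      (c := c) (j := j) (by rw [hF₁.2 _ (by simp), hc]) (by rw [hF₁.2 _ (by simp), hj]) ?_ ?_ ?_ ?_)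
    · rw [hconf]
      intro k
      have := hv'.done_le_one k
      omega
    · rw [hconf]
      exact h.start_le _ hl _ hv'
    · rw [hconf]
      exact h.cost_le _ hl _ hv'
    intro s₂ hF₂ hcand
    rw [hconf] at hcand
    have hG₂ : Grows n scratch a s s₂ := hG₁.trans
      ((hF₂.grows (by simp) (by simp) (by simp) (by simp) a).mono (by simp [scratch]))
    refine insertCandidate h (l := l + 1) (a := a) ?_ rfl ?_ hl haM (by rwa [hcand]) ?_
    · rw [hF₂.2 _ (by simp), hF₁.2 _ (by simp), ha]
    · rwa [hF₂.2 _ (by simp), hlen, hF₂.config_eq (n := n) (by simp) (by simp) (by simp), hconf]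
    · intro s₃ hG₃ hT₃ hcov
      rw [hcand] at hcov
      exact hQ s₃ (hG₂.trans hG₃) hT₃ fun _ => hcov

/-- Layer `l` occupies positions `a` to `b - 1`, and the next layer grows from `b` on. Writes never
touch positions below `b`, so the configurations being read are those of the initial state. -/
theorem expandLayer (h : Setting x M N r d p q) {s : State} {l a b : ℕ}
    (ha : s.get .lo 0 0 = a) (hb : s.get .hi 0 0 = b) (hlen : s.get .len 0 0 = b)
    (hT : Table r d p q l a b (s.config n)) (hl : l < n) (hbM : b + N + 1 ≤ M)
    {Q : State → Prop}
    (hQ : ∀ s' b', s'.out = s.out → s'.get .layer 0 0 = s.get .layer 0 0 →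
      s'.get .lo 0 0 = b → s'.get .hi 0 0 = b' → s'.get .len 0 0 = b' →
      Table r d p q (l + 1) b b' (s'.config n) →
      (∀ c, a ≤ c → c < b → ∀ j, Eligible r d (s.config n c) j →
        Covered (s'.config n) b b' ((s.config n c).extend d j)) → Q s') :
    Runs x M .expandLayer s (layerSteps n N) Q := by
  have hM : 0 < M := by omega
  have hnM := h.num_le
  have hN : b - a ≤ N := (hT.card_le hl.le).trans h.card_le
  -- Initially `len = b`, so the new layer is empty.
  have hT₀ : Table r d p q (l + 1) b (s.get .len 0 0) (s.config n) :=
    ⟨by omega, fun i h₁ h₂ => by omega, fun i i' h₁ h₂ => by omega⟩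
  refine seq hM (by omega) ((loop h.fits (m := n * (jobSteps n N + 3) + 2) (a := a) (b := b)
    (fun t s' => Grows n (.cur :: .job :: scratch) b s s' ∧
      Table r d p q (l + 1) b (s'.get .len 0 0) (s'.config n) ∧
      ∀ c, a ≤ c → c < t → ∀ j, Eligible r d (s.config n c) j →
        Covered (s'.config n) b (s'.get .len 0 0) ((s.config n c).extend d j))
    hT.le (by omega) (by simp [ha]) ?_ ?_ ?_ ?_).mono
    (Nat.add_le_add_right (Nat.mul_le_mul_right _ hN) 2))
  · refine ⟨(grows_put n s _ _ _ (by simp) (by simp) (by simp) (by simp) b).mono (by simp), ?_, ?_⟩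
    · simpa [config_put] using hT₀
    · intro c h₁ h₂
      omega
  · rintro i s' ⟨hG, -⟩
    rw [Expr.eval_var, hG.frame.2 _ (by simp [scratch]), hb]
  · rintro c s₁ hac hcb ⟨hG₁, hT₁, hcov₁⟩ hcur
    refine (loop h.fits (m := jobSteps n N) (a := 0) (b := n)
      (fun t s' => Grows n (.job :: scratch) b s₁ s' ∧
        Table r d p q (l + 1) b (s'.get .len 0 0) (s'.config n) ∧
        ∀ j : Fin n, j < t → Eligible r d (s.config n c) j →
          Covered (s'.config n) b (s'.get .len 0 0) ((s.config n c).extend d j))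
      zero_le (by omega) rfl ?_ ?_ ?_ ?_).mono (by rw [Nat.sub_zero])
    · refine ⟨(grows_put n s₁ _ _ _ (by simp) (by simp) (by simp) (by simp) b).mono (by simp),
        ?_, ?_⟩
      · simpa [config_put] using hT₁
      · intro j hj
        omega
    · intro i s' _
      exact h.describes.num
    · rintro j s₂ - hjn ⟨hG₂, hT₂, hcov₂⟩ hjob
      have hconf : s₂.config n c = s.config n c := by
        rw [hG₂.old c hcb, hG₁.old c hcb]
      refine expandJob h (j := ⟨j, hjn⟩) (c := c) (a := b) ?_ hjob ?_ hT₂ hl hbM ?_ ?_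
      · rw [hG₂.frame.2 _ (by simp [scratch]), hcur]
      · rw [hG₂.frame.2 _ (by simp [scratch]), hG₁.frame.2 _ (by simp [scratch]), hb]
      · rw [hconf]
        exact hT.valid c hac hcb
      · intro s₃ hG₃ hT₃ hcov₃
        rw [hconf] at hcov₃
        refine ⟨by rw [hG₃.frame.2 _ (by simp [scratch]), hjob], ?_, ?_, ?_⟩
        · exact (hG₂.trans (hG₃.mono (by simp))).trans
            ((grows_put n s₃ _ _ _ (by simp) (by simp) (by simp) (by simp) b).mono (by simp))
        · simpa [config_put] using hT₃
        · intro j' hj' hel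
          simp only [get_put, reduceCtorEq, false_and, if_false]
          rw [config_put _ _ _ _ _ (by simp) (by simp) (by simp)]
          rcases Nat.lt_succ_iff_lt_or_eq.1 hj' with hlt | heq
          · exact hG₃.covered _ (hcov₂ j' hlt hel)
          · have : j' = ⟨j, hjn⟩ := Fin.ext heq
            subst this
            exact hcov₃ hel
    · rintro s₂ ⟨hG₂, hT₂, hcov₂⟩
      refine ⟨by rw [hG₂.frame.2 _ (by simp [scratch]), hcur], ?_, ?_, ?_⟩
      · exact (hG₁.trans (hG₂.mono (by simp))).trans
          ((grows_put n s₂ _ _ _ (by simp) (by simp) (by simp) (by simp) b).mono (by simp))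
      · simpa [config_put] using hT₂
      · intro c' hac' hc' j hel
        simp only [get_put, reduceCtorEq, false_and, if_false]
        rw [config_put _ _ _ _ _ (by simp) (by simp) (by simp)]
        rcases Nat.lt_succ_iff_lt_or_eq.1 hc' with hlt | rfl
        · exact hG₂.covered _ (hcov₁ c' hac' hlt j hel)
        · exact hcov₂ j j.isLt hel
  · rintro s₁ ⟨hG₁, hT₁, hcov₁⟩
    have hhi : s₁.get .hi 0 0 = b := by rw [hG₁.frame.2 _ (by simp [scratch]), hb]
    have hlen₁ : s₁.get .len 0 0 ≤ M := by
      have h₁ := (hT₁.card_le hl).trans h.card_le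
      omega
    refine seq (n := 1) (n' := 1) hM one_pos (set h.fits ?_ (set h.fits ?_
      (hQ _ (s₁.get .len 0 0) ?_ ?_ ?_ ?_ ?_ ?_ ?_)))
    · rw [Expr.eval_var, hhi]
      omega
    · simpa using hlen₁
    · simpa using hG₁.frame.1
    · simpa using hG₁.frame.2 .layer (by simp [scratch]) 0 0
    · simpa using hhi
    · simp
    · simp
    · simpa [config_put] using hT₁
    · simpa [config_put] using hcov₁

/-- Loop invariant: every schedule `S` is matched by some entry of the current layer that has a
completion of total cost at most that of `S`. After `n` layers nothing is left to complete, and the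
entry itself is optimal. -/
theorem schedule (h : Setting x M N r d p q) :
    Runs x M .schedule State.init (totalSteps n N) fun s' => ∃ T : Fin n → ℕ,
      s'.out = (List.finRange n).map T ∧ Completes d (empty r) (fun k => (T k : ℝ)) ∧
      ∀ S, Completes d (empty r) S → (∑ k, (T k : ℝ)) ≤ ∑ k, S k := by
  have hM : 0 < M := by have := h.num_le; omega
  have hnM := h.num_le
  have hfill : ∀ k < n, ∀ s', Frame [.k, .start] State.init s' → s'.get .k 0 0 = k →
      (Expr.release (.var .k)).eval x s'.mem = if h : k < n then r ⟨k, h⟩ else 0 := by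
    intro k hk s' _ hks
    rw [dif_pos hk, ← h.describes.release ⟨k, hk⟩]
    simp only [Expr.release, Expr.eval_input, Expr.eval_add, Expr.eval_mul, Expr.eval_const,
      Expr.eval_var, hks]
  refine seq hM (by omega) (fill h.fits h.describes.num (by omega) 0 _ (by simp) (fun _ _ => rfl)
    hfill ?_ ?_)
  · intro k hk
    rw [dif_pos hk]
    exact h.start_le 0 zero_le _ (valid_empty r d p q) ⟨k, hk⟩
  intro s₁ hF₁ hs₁
  refine seq hM one_pos (set h.fits (by rw [Expr.eval_const]; omega) ?_)
  refine seq hM one_pos (set h.fits (by rw [Expr.eval_const]; omega) ?_)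
  simp only [Expr.eval_const]
  -- Only the release dates had to be written: memory starts at zero, which already gives the right
  -- flags, cost and `lo`.
  have hconf : ((s₁.put .hi 0 0 1).put .len 0 0 1).config n 0 = empty r := by
    rw [config_put _ _ _ _ _ (by simp) (by simp) (by simp),
      config_put _ _ _ _ _ (by simp) (by simp) (by simp)]
    ext k
    · exact hF₁.2 .done (by simp) 0 k
    · simp [State.config, hs₁, empty]
    · exact hF₁.2 .cost (by simp) 0 0
  -- All layers share one array. The first has one entry and each later one at most `N`, and one
  -- more position is needed for appending.
  have hNM : ∀ l, l < n → 1 + l * N + N + 1 ≤ M := by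
    intro l hl
    have h₁ := Nat.mul_le_mul_right N (Nat.succ_le_succ hl.le)
    have h₂ := h.table_le
    rw [Nat.succ_mul, Nat.succ_eq_add_one] at h₁
    omega
  refine seq hM (by omega) ((loop h.fits (m := layerSteps n N) (a := 0) (b := n)
    (fun l s' => s'.out = [] ∧ ∃ a b, s'.get .lo 0 0 = a ∧ s'.get .hi 0 0 = b ∧
      s'.get .len 0 0 = b ∧ b ≤ 1 + l * N ∧ Table r d p q l a b (s'.config n) ∧
      ∀ S, Completes d (empty r) S → ∃ i, a ≤ i ∧ i < b ∧ ∃ S', Completes d (s'.config n i) S' ∧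
        (s'.config n i).cost + (s'.config n i).rest S' ≤ ∑ k, S k)
    zero_le (by omega) rfl ?_ ?_ ?_ ?_).mono (by rw [Nat.sub_zero]))
  · refine ⟨hF₁.1, 0, 1, ?_, by simp, by simp, by simp, ⟨zero_le, ?_, ?_⟩, ?_⟩
    · simp only [get_put, reduceCtorEq, false_and, if_false]
      exact hF₁.2 .lo (by simp) 0 0
    · intro i _ hi
      have : i = 0 := by omega
      subst this
      rw [config_put _ _ _ _ _ (by simp) (by simp) (by simp), hconf]
      exact valid_empty r d p q
    · intros
      omega
    · intro S hS
      refine ⟨0, le_rfl, one_pos, S, ?_, ?_⟩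
      · rwa [config_put _ _ _ _ _ (by simp) (by simp) (by simp), hconf]
      · rw [config_put _ _ _ _ _ (by simp) (by simp) (by simp), hconf]
        simp [empty, rest]
  · intro i s' _
    exact h.describes.num
  · rintro l s₂ - hl ⟨hout, a, b, ha, hb, hlen, hbN, hT, hopt⟩ hlayer
    refine expandLayer h ha hb hlen hT hl (by have := hNM l hl; omega) ?_
    intro s₃ b' hout₃ hlayer₃ hlo₃ hhi₃ hlen₃ hT₃ hcov
    refine ⟨hlayer₃.trans hlayer, hout₃.trans hout, b, b', by simpa using hlo₃, by simpa using hhi₃,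
      by simpa using hlen₃, ?_, ?_, ?_⟩
    · have h₁ := (hT₃.card_le hl).trans h.card_le
      rw [Nat.succ_mul]
      omega
    · simpa [config_put] using hT₃
    · intro S hS
      rw [config_put _ _ _ _ _ (by simp) (by simp) (by simp)]
      obtain ⟨i, hai, hib, S', hS', hle⟩ := hopt S hS
      have hvi := hT.valid i hai hib
      -- The exchange argument extends the matching entry by an eligible job. The extension is
      -- covered in the next layer by an entry with the same key, which therefore has the same
      -- completions, at no larger cost.
      obtain ⟨j, hj, S'', hS'', hle'⟩ := exists_eligible_extend h.symm hvi.start_mono hS'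
        (hvi.exists_not_done hl)
      obtain ⟨i', h₁, h₂, h₃, h₄⟩ := hcov i hai hib j hj
      refine ⟨i', h₁, h₂, S'', hS''.of_sameKey h₃.symm, ?_⟩
      rw [h₃.rest_eq]
      have h₅ : ((s₃.config n i').cost : ℝ) ≤ (s₂.config n i).cost + (s₂.config n i).start j := by
        exact_mod_cast h₄
      linarith
  · rintro s₂ ⟨hout, a, b, ha, hb, hlen, hbN, hT, hopt⟩
    refine (loop h.fits (m := 1) (a := 0) (b := n)
      (fun t s' => s'.out = (List.range t).map (fun k => s₂.get .start a k) ∧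
        s'.get .lo 0 0 = a ∧ ∀ i k, s'.get .start i k = s₂.get .start i k)
      zero_le (by omega) rfl ?_ ?_ ?_ ?_).mono (by rw [Nat.sub_zero])
    · simpa [hout] using ha
    · intro i s' _
      exact h.describes.num
    · rintro t s' - ht ⟨ho, hlo, hs⟩ hk
      refine write h.fits ⟨hk, ?_, ?_, ?_⟩
      · simp only [out_put, ho, Expr.eval_arr, Expr.eval_var, hlo, hk, hs, List.range_succ,
          List.map_append, List.map_cons, List.map_nil]
      · rw [get_put, if_neg (by simp)]
        exact hlo
      · intro i k
        rw [get_put, if_neg (by simp)]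
        exact hs i k
    · rintro s₃ ⟨ho, -, -⟩
      -- In the last layer all jobs are done, so all keys agree and distinctness leaves at most the
      -- entry at `a`.
      have hex : ∀ S, Completes d (empty r) S → a < b ∧ ((s₂.config n a).cost : ℝ) ≤ ∑ k, S k := by
        intro S hS
        obtain ⟨i, hai, hib, S', -, hle⟩ := hopt S hS
        have hvi := hT.valid i hai hib
        have hva := hT.valid a le_rfl (by omega)
        have : i = a := hT.distinct i a hai hib le_rfl (by omega) fun k =>
          ⟨by rw [hvi.done_eq_one, hva.done_eq_one], fun h₀ => by
            rw [hvi.done_eq_one] at h₀; omega⟩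
        subst this
        refine ⟨hib, ?_⟩
        have hrest : (s₂.config n i).rest S' = 0 :=
          Finset.sum_eq_zero fun k _ => by simp [hvi.done_eq_one]
        linarith
      have hab : a < b := by
        refine (hex (fun k => ((∑ i, r i + k * (p + q) : ℕ) : ℝ)) ⟨fun k _ => ?_, ?_⟩).1
        · refine Nat.cast_le.2 ?_
          exact (Finset.single_le_sum (fun _ _ => zero_le) (Finset.mem_univ k)).trans
            (Nat.le_add_right _ _)
        · intro j k hjk _ _
          have hd : d j k ≤ p + q := by
            rcases h.values j k with e | e | e <;> omega
          have key : ∀ u v : Fin n, u < v →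
              (∑ i, r i + u * (p + q)) + d j k ≤ ∑ i, r i + v * (p + q) := by
            intro u v huv
            have := Nat.mul_le_mul_right (p + q) (Nat.succ_le_of_lt (Fin.lt_def.1 huv))
            rw [Nat.succ_mul] at this
            omega
          beta_reduce
          rcases lt_or_gt_of_ne hjk with hlt | hlt
          · exact .inl (by exact_mod_cast key j k hlt)
          · exact .inr (by exact_mod_cast key k j hlt)
      have hva := hT.valid a le_rfl hab
      refine ⟨(s₂.config n a).start, ?_, ⟨fun k _ => Nat.cast_le.2 (hva.release_le k), ?_⟩, ?_⟩
      · rw [ho, ← List.map_coe_finRange_eq_range, List.map_map]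
        rfl
      · intro j k hjk _ _
        have h₁ := hva.done_eq_one
        have := hva.separated j k hjk (by simp [h₁]) (by simp [h₁])
        beta_reduce
        exact_mod_cast this
      · intro S hS
        refine le_trans (le_of_eq ?_) (hex S hS).2
        rw [hva.cost_eq]
        simp [hva.done_eq_one]

end Runs
end BidirScheduling

/-! ### Reading the encoded input, and bounds by its length. -/

namespace BidirScheduling

theorem finRange_of_eq_one {m : ℕ} (h : m = 1) : List.finRange m = [⟨0, by omega⟩] := by
  subst h
  rfl

theorem getD_flatMap_finRange {n w : ℕ} (f : Fin n → List ℕ) (hf : ∀ j, (f j).length = w)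
    (j : Fin n) {a : ℕ} (ha : a < w) :
    ((List.finRange n).flatMap f).getD (w * j + a) 0 = (f j).getD a 0 := by
  induction n with
  | zero => exact j.elim0
  | succ n ih =>
    rw [List.finRange_succ, List.flatMap_cons, List.flatMap_map]
    refine Fin.cases ?_ (fun j => ?_) j
    · rw [List.getD_append _ _ _ _ (by simp [hf, ha])]
      simp
    · rw [List.getD_append_right _ _ _ _ (by simp [hf]; nlinarith)]
      rw [← ih (fun j => f j.succ) (fun j => hf _) j]
      congr 1
      rw [hf, Fin.val_succ, Nat.mul_succ]
      omega

theorem length_flatMap_finRange {n w : ℕ} (f : Fin n → List ℕ) (hf : ∀ j, (f j).length = w) :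
    ((List.finRange n).flatMap f).length = w * n := by
  rw [List.length_flatMap]
  simp [hf, mul_comm]

/-- The common length matters: for `l = 0` both sides are true, whereas an empty interval inside a
longer one would be disjoint from it without preceding or following it. -/
theorem Ico_inter_Ico_add_eq_empty_iff (y z l : ℝ) :
    Set.Ico y (y + l) ∩ Set.Ico z (z + l) = ∅ ↔ y + l ≤ z ∨ z + l ≤ y := by
  rw [Set.Ico_inter_Ico, Set.Ico_eq_empty_iff, max_lt_iff, lt_min_iff, lt_min_iff]
  constructor
  · intro h
    by_contra! h'
    exact h ⟨⟨by linarith, h'.2⟩, h'.1, by linarith⟩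
  · rintro (h | h) ⟨⟨h₁, h₂⟩, h₃, h₄⟩ <;> linarith

theorem bitLength_le_inputSize {x : List ℕ} {v : ℕ} (hv : v ∈ x) : bitLength v ≤ inputSize x :=
  List.single_le_sum (fun _ _ => zero_le) _ (List.mem_map_of_mem hv)

theorem length_le_inputSize (x : List ℕ) : x.length ≤ inputSize x := by
  have := List.length_le_sum_of_one_le (x.map bitLength) fun v hv => by
    obtain ⟨u, -, rfl⟩ := List.mem_map.1 hv
    exact Nat.succ_le_succ zero_le
  rwa [List.length_map] at this

theorem le_two_pow_inputSize {x : List ℕ} {v : ℕ} (hv : v ∈ x) : v ≤ 2 ^ inputSize x :=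
  (Nat.lt_size_self v).le.trans (Nat.pow_le_pow_right two_pos
    ((Nat.le_succ _).trans (bitLength_le_inputSize hv)))

theorem getD_le_two_pow (x : List ℕ) (i : ℕ) : x.getD i 0 ≤ 2 ^ inputSize x := by
  by_cases h : i < x.length
  · rw [List.getD_eq_getElem _ _ h]
    exact le_two_pow_inputSize (List.getElem_mem h)
  · rw [List.getD_eq_default _ _ (by omega)]
    exact zero_le

/-! ### One-segment instances as problems with minimum distances. -/

namespace Inst

variable (I : Inst)

open Classical in
/-- The minimum distance between the start times of two jobs on segment `i`. -/
noncomputable def distance (i : Fin I.m) (j k : Fin I.n) : ℕ :=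
  if I.Compatible i j k then 0
  else I.proc j + if I.right j = I.right k then 0 else I.transit i

variable {I}

theorem Compatible.symm {i : Fin I.m} {j k : Fin I.n} (h : I.Compatible i j k) :
    I.Compatible i k j := Or.symm h

theorem not_compatible_of_right_eq {i : Fin I.m} {j k : Fin I.n} (h : I.right j = I.right k) :
    ¬ I.Compatible i j k := by
  rintro (h' | h') <;> have := I.edge_dir i _ _ h' <;> simp_all

open Classical in
theorem distance_comm {p : ℕ} (hp : ∀ j, I.proc j = p) (i : Fin I.m) (j k : Fin I.n) :
    I.distance i j k = I.distance i k j := by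
  have h : I.Compatible i j k ↔ I.Compatible i k j := ⟨Compatible.symm, Compatible.symm⟩
  rw [distance, distance, hp, hp]
  exact if_congr h rfl (by simp only [eq_comm (a := I.right j)])

theorem distance_eq_or {p : ℕ} (hp : ∀ j, I.proc j = p) (i : Fin I.m) (j k : Fin I.n) :
    I.distance i j k = 0 ∨ I.distance i j k = p ∨ I.distance i j k = p + I.transit i := by
  simp only [distance, hp]
  split_ifs <;> simp

/-- With identical processing times, direction and compatible jobs determine the row, so the row map
factors through the types. -/
theorem card_distance_le {p : ℕ} (hp : ∀ j, I.proc j = p) (i : Fin I.m) :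
    (Finset.univ.image (I.distance i)).card ≤ I.numTypes := by
  classical
  have hlift : ∀ j k, I.sameType.r j k → I.distance i j = I.distance i k := by
    rintro j k ⟨h₁, h₂⟩
    funext l
    have h₃ : I.Compatible i j l ↔ I.Compatible i k l := Set.ext_iff.1 (h₂ i) l
    simp only [distance, hp, h₁, h₃]
  have himage : Finset.univ.image (I.distance i) =
      Finset.univ.image (Quotient.lift (s := I.sameType) (I.distance i) hlift) := by
    ext y
    simp only [Finset.mem_image, Finset.mem_univ, true_and]
    constructor
    · rintro ⟨j, rfl⟩
      exact ⟨Quotient.mk _ j, rfl⟩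
    · rintro ⟨j, rfl⟩
      induction j using Quotient.ind with
      | _ j => exact ⟨j, rfl⟩
  rw [himage, numTypes, Nat.card_eq_fintype_card]
  exact Finset.card_image_le

theorem encode_of_one_segment (hm : I.m = 1) :
    I.encode = ([I.m, I.n, I.transit ⟨0, by omega⟩] ++
      (List.finRange I.n).flatMap (fun j =>
        [(I.right j).toNat, I.release j, I.proc j, (I.source j).val, (I.target j).val])) ++
      (List.finRange I.n).flatMap (fun j => (List.finRange I.n).map fun j' =>
        (I.edge ⟨0, by omega⟩ j j').toNat) := by
  rw [encode, List.ofFn_eq_map, finRange_of_eq_one hm]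
  simp

/-- With one segment the layout is `m`, `n`, the transit time, then from position `3` five numbers
per job, and from position `3 + 5 * n` the adjacency matrix row by row. -/
theorem describes_encode (hm : I.m = 1) :
    Describes I.encode I.release (I.distance ⟨0, by omega⟩) := by
  have hjobs : ∀ (j : Fin I.n) a, a < 5 → I.encode.getD (3 + a + 5 * j) 0 =
      [(I.right j).toNat, I.release j, I.proc j, (I.source j).val, (I.target j).val].getD a 0 := by
    intro j a ha
    have hj := j.isLt
    rw [encode_of_one_segment hm, List.getD_append, List.getD_append_right]
    · refine Eq.trans ?_ (getD_flatMap_finRange (w := 5) (fun j =>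
        [(I.right j).toNat, I.release j, I.proc j, (I.source j).val, (I.target j).val])
        (fun _ => rfl) j ha)
      congr 1
      simp only [List.length_cons, List.length_nil]
      omega
    · simp
      omega
    · rw [List.length_append, length_flatMap_finRange (w := 5) _ fun _ => rfl]
      simp
      omega
  have hedge : ∀ j k : Fin I.n, I.encode.getD (3 + 5 * I.n + (I.n * j + k)) 0 =
      (I.edge ⟨0, by omega⟩ j k).toNat := by
    intro j k
    rw [encode_of_one_segment hm, List.getD_append_right]
    · rw [List.length_append, length_flatMap_finRange (w := 5) _ fun _ => rfl]
      have := getD_flatMap_finRange (w := I.n) (fun j => (List.finRange I.n).map fun j' =>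
        (I.edge ⟨0, by omega⟩ j j').toNat) (fun _ => by simp) j k.isLt
      simp only [List.length_cons, List.length_nil, Nat.add_sub_cancel_left]
      rw [this, List.getD_eq_getElem _ _ (by simp)]
      simp
    · rw [List.length_append, length_flatMap_finRange (w := 5) _ fun _ => rfl]
      simp
  have hnum : I.encode.getD 1 0 = I.n := by
    rw [encode_of_one_segment hm]
    rfl
  have htransit : I.encode.getD 2 0 = I.transit ⟨0, by omega⟩ := by
    rw [encode_of_one_segment hm]
    rfl
  refine ⟨hnum, fun j => hjobs j 1 (by omega), fun m e f j k he hf => ?_⟩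
  have h₀ : ∀ j : Fin I.n, I.encode.getD (3 + 5 * j) 0 = (I.right j).toNat := fun j => hjobs j 0 (by omega)
  have h₂ : ∀ j : Fin I.n, I.encode.getD (5 + 5 * j) 0 = I.proc j := fun j => hjobs j 2 (by omega)
  simp only [Expr.dist, Expr.adjacent, Expr.direction, Expr.num, Expr.eval_mul, Expr.eval_sub,
    Expr.eval_const, Expr.eval_add, Expr.eval_input, Expr.eval_differ, he, hf, hnum, hedge, h₀, h₂,
    htransit, distance, Compatible]
  rcases Bool.eq_false_or_eq_true (I.edge ⟨0, by omega⟩ j k) with h₃ | h₃ <;>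
    rcases Bool.eq_false_or_eq_true (I.edge ⟨0, by omega⟩ k j) with h₄ | h₄ <;>
    rcases Bool.eq_false_or_eq_true (I.right j) with h₅ | h₅ <;>
    rcases Bool.eq_false_or_eq_true (I.right k) with h₆ | h₆ <;> simp [h₃, h₄, h₅, h₆]

/-- The intervals that must be disjoint have a common length, `p` or `p + τ`, so disjointness is
separation of start times. For a compatible pair the distance is `0` and separation holds by
totality of the order. -/
theorem completes_iff_feasible (hm : I.m = 1) {p : ℕ} (hp : ∀ j, I.proc j = p) (S : I.Schedule) :
    PartialSchedule.Completes (I.distance ⟨0, by omega⟩) (PartialSchedule.empty I.release)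
      (S ⟨0, by omega⟩) ↔ I.Feasible S := by
  have hsub : ∀ i : Fin I.m, i = ⟨0, by omega⟩ := fun i => Fin.ext (by have := i.isLt; omega)
  have hseg : ∀ i j, i ∈ I.segments j := fun i j => by
    rw [hsub i, ← hsub (I.source j)]
    exact Set.left_mem_uIcc
  constructor
  · rintro ⟨h₁, h₂⟩
    refine ⟨fun j => ?_, ?_, ?_, ?_, ?_⟩
    · rw [hsub (I.source j)]
      exact h₁ j rfl
    -- The travel conditions are vacuous, as there are no two consecutive segments.
    · intro j _ i _ i' _ h
      rw [hsub i, hsub i'] at h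
      simp at h
    · intro j _ i _ i' _ h
      rw [hsub i, hsub i'] at h
      simp at h
    · intro i j k hjk _ _ hdir
      rw [hsub i, processing, processing, hp, hp, Ico_inter_Ico_add_eq_empty_iff]
      have := h₂ j k hjk rfl rfl
      rwa [distance, if_neg (not_compatible_of_right_eq hdir), if_pos hdir, hp] at this
    · intro i j k _ _ hdir hcomp
      rw [hsub i] at hcomp ⊢
      rw [running, running, segCompletion, segCompletion, hp, hp, add_assoc, add_assoc,
        Ico_inter_Ico_add_eq_empty_iff]
      have := h₂ j k (fun h => hdir (by rw [h])) rfl rfl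
      rwa [distance, if_neg hcomp, if_neg hdir, hp, Nat.cast_add] at this
  · intro h
    refine ⟨fun j _ => ?_, fun j k hjk _ _ => ?_⟩
    · have := h.release_le j
      rwa [hsub (I.source j)] at this
    · rw [distance]
      split_ifs with hcomp hdir
      · simpa using le_total _ _
      · have := h.same_direction _ j k hjk (hseg ⟨0, by omega⟩ j) (hseg _ k) hdir
        rw [processing, processing, hp, hp,
          Ico_inter_Ico_add_eq_empty_iff] at this
        rwa [hp, add_zero]
      · have := h.opposite_direction _ j k (hseg ⟨0, by omega⟩ j) (hseg _ k) hdir hcomp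
        rw [running, running, segCompletion, segCompletion, hp, hp, add_assoc, add_assoc,
          Ico_inter_Ico_add_eq_empty_iff] at this
        rwa [hp, Nat.cast_add]

theorem totalCompletion_eq (hm : I.m = 1) (S : I.Schedule) :
    I.totalCompletion S = ∑ j, S ⟨0, by omega⟩ j +
      ∑ j, ((I.proc j : ℝ) + I.transit ⟨0, by omega⟩) := by
  have hsub : ∀ i : Fin I.m, i = ⟨0, by omega⟩ := fun i => Fin.ext (by have := i.isLt; omega)
  rw [totalCompletion, ← Finset.sum_add_distrib]
  refine Finset.sum_congr rfl fun j _ => ?_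
  rw [completion, segCompletion, hsub (I.target j), add_assoc]

/-- The setting of the scheduling program for an instance with a single segment. -/
theorem setting_encode {κ : ℕ} (hm : I.m = 1) {p : ℕ} (hp : ∀ j, I.proc j = p)
    (hκ : I.numTypes ≤ κ) :
    I.n ≤ inputSize I.encode ∧
    Setting I.encode (2 ^ ((4 * κ + 10) * (inputSize I.encode + 1)))
      ((inputSize I.encode + 1) ^ (4 * κ)) I.release (I.distance ⟨0, by omega⟩) p
      (p + I.transit ⟨0, by omega⟩) := by
  have hD := describes_encode hm
  have hentry := getD_le_two_pow I.encode
  have hn : I.n ≤ inputSize I.encode := by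
    refine le_trans ?_ (length_le_inputSize _)
    rw [encode_of_one_segment hm, List.length_append, List.length_append,
      length_flatMap_finRange (w := 5) _ fun _ => rfl]
    omega
  have htransit : I.transit ⟨0, by omega⟩ ≤ 2 ^ inputSize I.encode :=
    le_two_pow_inputSize (by simp [encode])
  have hproc : ∀ j, I.proc j ≤ 2 ^ inputSize I.encode := fun j => by
    refine le_two_pow_inputSize ?_
    simp only [encode, List.mem_append, List.mem_flatMap]
    exact .inl (.inr ⟨j, List.mem_finRange j, by simp⟩)
  have hrelease : ∀ j, I.release j ≤ 2 ^ inputSize I.encode := fun j => by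
    rw [← hD.release j]
    exact hentry _
  generalize inputSize I.encode = B at *
  have hB : B + 1 ≤ 2 ^ B := Nat.lt_two_pow_self
  have hpow : ∀ e, e ≤ (4 * κ + 10) * (B + 1) → 2 ^ e ≤ 2 ^ ((4 * κ + 10) * (B + 1)) :=
    fun e he => Nat.pow_le_pow_right two_pos he
  -- With `B` the input length, the terms add up to at most `(3 * B + 1) * 2 ^ B`, and `B + 1 ≤ 2 ^
  -- B`.
  have hstart : ∀ l ≤ I.n, ∀ c, PartialSchedule.Valid I.release (I.distance ⟨0, by omega⟩) p
      (p + I.transit ⟨0, by omega⟩) l c → ∀ k, c.start k ≤ 2 ^ (2 * B + 2) := by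
    intro l hl c hc k
    refine (le_of_mem_candidates (hc.mem_candidates k) hrelease).trans ?_
    have hpB : p ≤ 2 ^ B := hp k ▸ hproc k
    have h₁ : l * p ≤ B * 2 ^ B := Nat.mul_le_mul (hl.trans hn) hpB
    have h₂ : l * (p + I.transit ⟨0, by omega⟩) ≤ B * (2 ^ B + 2 ^ B) :=
      Nat.mul_le_mul (hl.trans hn) (Nat.add_le_add hpB htransit)
    have h₃ : (2 : ℕ) ^ (2 * B + 2) = 4 * (2 ^ B * 2 ^ B) := by ring
    have h₄ := Nat.mul_le_mul_right (2 ^ B) hB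
    rw [h₃]
    nlinarith
  refine ⟨hn, ⟨?_, ?_⟩, hD, distance_comm hp _, distance_eq_or hp _, ?_, ?_, ?_, ?_, ?_⟩
  · exact Nat.le_self_pow (by positivity) 2
  · exact fun i => (hentry i).trans (hpow _ (by nlinarith))
  · refine le_trans ?_ (hpow (B + 1) (by nlinarith))
    rw [pow_succ]
    omega
  · exact fun l hl c hc k => (hstart l hl c hc k).trans (hpow _ (by nlinarith))
  · intro l hl c hc
    rw [hc.cost_eq]
    calc ∑ k, c.done k * c.start k ≤ ∑ _k : Fin I.n, 1 * 2 ^ (2 * B + 2) :=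
          Finset.sum_le_sum fun k _ => Nat.mul_le_mul (hc.done_le_one k) (hstart l hl c hc k)
      _ = I.n * 2 ^ (2 * B + 2) := by simp
      _ ≤ 2 ^ B * 2 ^ (2 * B + 2) := Nat.mul_le_mul_right _ (by omega)
      _ = 2 ^ (3 * B + 2) := by ring
      _ ≤ _ := hpow _ (by nlinarith)
  · calc ((I.n + 1) * (I.n * (I.n + 1) ^ 2 + 1)) ^ _
        ≤ ((I.n + 1) * (I.n * (I.n + 1) ^ 2 + 1)) ^ κ :=
          Nat.pow_le_pow_right (by positivity) ((card_distance_le hp _).trans hκ)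
      -- Here `n * (n + 1) ^ 2 + 1 ≤ (n + 1) ^ 3`; this is the source of the exponent `4 * κ` in
      -- `N`.
      _ ≤ ((I.n + 1) ^ 4) ^ κ := by
          refine Nat.pow_le_pow_left ?_ κ
          nlinarith [Nat.zero_le (I.n ^ 3), Nat.zero_le (I.n ^ 2), Nat.zero_le (I.n)]
      _ = (I.n + 1) ^ (4 * κ) := (pow_mul _ _ _).symm
      _ ≤ _ := Nat.pow_le_pow_left (by omega) _
  · calc (I.n + 1) * (B + 1) ^ (4 * κ) + 2 ≤ 2 ^ B * (2 ^ B) ^ (4 * κ) + 2 := by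
          gcongr
          omega
      _ = 2 ^ ((4 * κ + 1) * B) + 2 := by ring
      _ ≤ 2 ^ ((4 * κ + 1) * B) * 2 ^ 2 := by
          have := Nat.one_le_two_pow (n := (4 * κ + 1) * B)
          omega
      _ = 2 ^ ((4 * κ + 1) * B + 2) := (pow_add _ _ _).symm
      _ ≤ _ := hpow _ (by nlinarith)

end Inst

theorem totalSteps_mono {n n' N : ℕ} (h : n ≤ n') : totalSteps n N ≤ totalSteps n' N := by
  unfold totalSteps layerSteps jobSteps
  gcongr

/-- The scheduling program solves the instances with a single segment, identical processing times
and at most `κ` compatibility types in polynomial time. -/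
theorem solvableInPolyTime_of_one_segment (κ : ℕ) : SolvableInPolyTime fun I =>
    I.m = 1 ∧ (∃ p : ℕ, ∀ j, I.proc j = p) ∧ I.numTypes ≤ κ := by
  -- `totalSteps` is defined over any commutative semiring, so the same expression serves as step
  -- count and as polynomial.
  refine ⟨.schedule, totalSteps .X ((.X + 1) ^ (4 * κ)) *
    (.C Prog.schedule.weight * (.C (4 * κ + 10) * (.X + 1) + 1)), ?_⟩
  rintro I ⟨hm, ⟨p, hp⟩, hκ⟩
  obtain ⟨hn, hS⟩ := Inst.setting_encode hm hp hκ
  obtain ⟨t, s, hexec, ht, -, T, hout, hfeas, hopt⟩ := Runs.schedule hS fun _ => zero_le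
  refine ⟨t, s, fun _ => T, hexec, ht.trans ?_, ?_, ?_, ?_⟩
  -- `M` is a power of two whose exponent is linear in the input length, so its length is this
  -- exponent plus one.
  · rw [Nat.size_pow]
    simp only [totalSteps, layerSteps, jobSteps, Polynomial.eval_mul, Polynomial.eval_add,
      Polynomial.eval_pow, Polynomial.eval_X, Polynomial.eval_C, Polynomial.eval_one,
      Polynomial.eval_ofNat]
    exact Nat.mul_le_mul_right _ (totalSteps_mono hn)
  · rw [hout, Inst.encodeSchedule, finRange_of_eq_one hm]
    simp
  · exact (Inst.completes_iff_feasible hm hp _).1 hfeas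
  · intro S' hS'
    rw [Inst.totalCompletion_eq hm, Inst.totalCompletion_eq hm]
    exact add_le_add_left (hopt _ ((Inst.completes_iff_feasible hm hp _).2 hS')) _

end BidirScheduling

theorem theorem5 (κ : ℕ) :
    BidirScheduling.SolvableInPolyTime (fun I =>
      I.m = 1 ∧ (∃ p : ℕ, ∀ j, I.proc j = p) ∧ I.numTypes ≤ κ) :=
  BidirScheduling.solvableInPolyTime_of_one_segment κ
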